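/- Let $T=\mathrm{conv}(x_1,x_2,x_3,x_4)\subset\mathbb{R}^3$ be a non-degenerate tetrahedron with barycentric coordinates $\lambda_1,\dots,\lambda_4$. For $n\ge 0$ let $\mathcal I_3^n=\{\alpha\in\mathbb{Z}_{\ge0}^4:\ \alpha_1+\alpha_2+\alpha_3+\alpha_4=n\}$ and $\mathring{\mathcal I}_3^n=\{\alpha\in\mathcal I_3^n:\ \alpha_k>0\text{ for all }k\}$; for a face $F$ of $T$ let $\tilde{\mathcal I}_3^n(F)=\{\alpha\in\mathcal I_3^n:\ \alpha_k=0\text{ whenever }x_k\notin F\}$. Let ${\mathcal I_3^n}'$ and $\tilde{\mathcal I}_3^n(F)'$ be $\mathcal I_3^n$ and $\tilde{\mathcal I}_3^n(F)$ with one arbitrarily chosen index removed. For $\alpha\in\mathcal I_3^n$ let $B^n_\alpha=\frac{n!}{\alpha_1!\,\alpha_2!\,\alpha_3!\,\alpha_4!}\,\lambda_1^{\alpha_1}\lambda_2^{\alpha_2}\lambda_3^{\alpha_3}\lambda_4^{\alpha_4}$. Put $\omega_{ij}=\lambda_i\nabla\lambda_j-\lambda_j\nabla\lambda_i$ and define: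 * for $\ell\in\{1,2,3,4\}$, with $i<j<k$ the three indices other than $\ell$, $\ \chi_\ell=\lambda_i\nabla\lambda_j\times\nabla\lambda_k-\lambda_j\nabla\lambda_i\times\nabla\lambda_k+\lambda_k\nabla\lambda_i\times\nabla\lambda_j$; * for a face $F=\mathrm{conv}(x_{i_1},x_{i_2},x_{i_3})$ (its vertices listed in any order) and $\alpha\in\tilde{\mathcal I}_3^n(F)$, $\ \Xi^{FT,n}_\alpha=(n+1)B^n_\alpha(\alpha_{i_1}\omega_{i_2i_3}+\alpha_{i_2}\omega_{i_3i_1}+\alpha_{i_3}\omega_{i_1i_2})$; * for $\ell\in\{1,2,3\}$ and $\alpha\in\mathring{\mathcal I}_3^{n+1}$, $\ \Xi^n_{\ell,\alpha}=(n+1)B^n_{\alpha-e_\ell}\nabla\lambda_\ell-\frac{\alpha_\ell}{n+1}\nabla B^{n+1}_\alpha$, where $e_\ell$ is the $\ell$-th unit multi-index; * for $\alpha\in\mathcal I_3^n$, $\ \Upsilon^n_\alpha=(n+1)B^n_\alpha\sum_{\ell=1}^4(-1)^\ell\alpha_\ell\chi_\ell$. Let $W^n$ be the collection of the fields $\operatorname{curl}\Xi^{FT,n}_\alpha$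 ($F$ a face of $T$, $\alpha\in\tilde{\mathcal I}_3^n(F)'$), the fields $\operatorname{curl}\Xi^{n+1}_{\ell,\alpha}$ ($\ell\in\{1,2\}$, $\alpha\in\mathring{\mathcal I}_3^{n+2}$), and the fields $\operatorname{curl}\Xi^{n+1}_{3,\alpha}$ ($\alpha\in\mathring{\mathcal I}_3^{n+2}$, $\alpha_3=1$). Let $\mathbb P_n$ and $\widetilde{\mathbb P}_n$ be the spaces of polynomials of degree at most $n$, respectively homogeneous of degree $n$, on $T$, and let $x$ be the position vector. **Theorem 4.2.** For every choice of the removed indices: 1. for every $n\ge0$, the sum $\mathbb P_n^3+x\,\widetilde{\mathbb P}_n$ is direct, and the collection $\{\chi_\ell:1\le\ell\le4\}\cup W^n\cup\{\Upsilon^n_\alpha:\alpha\in{\mathcal I_3^n}'\}$ is a basis of the Raviart–Thomas space $\mathbb P_n^3\oplus x\,\widetilde{\mathbb P}_n$; 2. for every $n\ge1$, the collection $\{\chi_\ell:1\le\ell\le4\}\cup W^n\cup\{\Upsilon^{n-1}_\alpha:\alpha\in{\mathcal I_3^{n-1}}'\}$ is a basis of $\mathbb P_n^3$ (the BDM space).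 -/

import Mathlib

namespace BBTet

noncomputable section

open scoped Matrix

/-- Coordinate space `ℝ³`. Only its linear structure and its (unique) vector space topology are
used: gradient, curl and cross product are written in coordinates. -/
abbrev R3 : Type := Fin 3 → ℝ

/-- The vertices of a non-degenerate tetrahedron: four affinely independent points of `ℝ³`
(which therefore span it affinely). The vertices `x₁, …, x₄` are numbered `0, …, 3`. -/
abbrev Vertices : Type := AffineBasis (Fin 4) ℝ R3

/-- The tetrahedron `T = conv(x₁, x₂, x₃, x₄)`. -/
def tet (x : Vertices) : Set R3 := convexHull ℝ (Set.range x)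

/-! ### Differential operators on functions and vector fields on `ℝ³` -/

/-- The partial derivative `∂ᵢ f`. -/
def pd (i : Fin 3) (f : R3 → ℝ) (p : R3) : ℝ := fderiv ℝ f p (Pi.single i 1)

/-- The gradient of a scalar function. -/
def grad (f : R3 → ℝ) (p : R3) : R3 := fun i => pd i f p

/-- The curl of a vector field. -/
def curl (v : R3 → R3) (p : R3) : R3 :=
  ![pd 1 (fun q => v q 2) p - pd 2 (fun q => v q 1) p,
    pd 2 (fun q => v q 0) p - pd 0 (fun q => v q 2) p,
    pd 0 (fun q => v q 1) p - pd 1 (fun q => v q 0) p]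

/-! ### Multi-indices -/

/-- The multi-indices `α ∈ ℤ₊⁴` with `|α| = n`. -/
def idx (n : ℕ) : Set (Fin 4 → ℕ) := {α | ∑ k, α k = n}

/-- The multi-indices of `idx n` whose domain points lie on the face opposite to vertex `ℓ`. -/
def faceIdx (n : ℕ) (ℓ : Fin 4) : Set (Fin 4 → ℕ) := {α | α ∈ idx n ∧ α ℓ = 0}

/-- The multi-indices of `idx n` whose entries are all positive. -/
def cellIdx (n : ℕ) : Set (Fin 4 → ℕ) := {α | α ∈ idx n ∧ ∀ k, 0 < α k}

/-! ### Barycentric coordinates, Bernstein polynomials, and the vector fields -/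

/-- The barycentric coordinate `λₖ` with respect to the tetrahedron, as a function on `ℝ³`. -/
def bary (x : Vertices) (k : Fin 4) (p : R3) : ℝ := x.coord k p

/-- The Bernstein polynomial `Bⁿ_α = (n! / α!) λ^α`, for `α ∈ idx n`. -/
def bernstein (x : Vertices) (n : ℕ) (α : Fin 4 → ℕ) (p : R3) : ℝ :=
  ((n.factorial : ℝ) / ∏ k, ((α k).factorial : ℝ)) * ∏ k, bary x k p ^ α k

/-- The lowest order edge element `ω_{ij} = λᵢ ∇λⱼ - λⱼ ∇λᵢ`. -/
def omega (x : Vertices) (i j : Fin 4) (p : R3) : R3 :=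
  bary x i p • grad (bary x j) p - bary x j p • grad (bary x i) p

/-- The field `λᵢ ∇λⱼ × ∇λₖ - λⱼ ∇λᵢ × ∇λₖ + λₖ ∇λᵢ × ∇λⱼ`. -/
def whitney (x : Vertices) (i j k : Fin 4) (p : R3) : R3 :=
  bary x i p • (grad (bary x j) p ⨯₃ grad (bary x k) p)
    - bary x j p • (grad (bary x i) p ⨯₃ grad (bary x k) p)
    + bary x k p • (grad (bary x i) p ⨯₃ grad (bary x j) p)

/-- The lowest order face element `χ_ℓ`: the field `whitney x i j k` where `i < j < k` are the
three indices different from `ℓ` (`Fin.succAbove ℓ` enumerates them in increasing order). -/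
def chi (x : Vertices) (ℓ : Fin 4) : R3 → R3 :=
  whitney x (ℓ.succAbove 0) (ℓ.succAbove 1) (ℓ.succAbove 2)

/-- The `H(curl)` face bubble
`Ξ^{FT,n}_α = (n+1) Bⁿ_α (α_{i₁} ω_{i₂i₃} + α_{i₂} ω_{i₃i₁} + α_{i₃} ω_{i₁i₂})` of the face
`F = conv(x_{i₁}, x_{i₂}, x_{i₃})`, where `iₖ = i k`, for `α` supported on `F`. -/
def faceBubble (x : Vertices) (n : ℕ) (i : Fin 3 → Fin 4) (α : Fin 4 → ℕ) (p : R3) : R3 :=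
  (((n : ℝ) + 1) * bernstein x n α p) •
    ((α (i 0) : ℝ) • omega x (i 1) (i 2) p + (α (i 1) : ℝ) • omega x (i 2) (i 0) p
      + (α (i 2) : ℝ) • omega x (i 0) (i 1) p)

/-- The `H(curl)` cell bubble
`Ξⁿ_{ℓ,α} = (n+1) Bⁿ_{α - e_ℓ} ∇λ_ℓ - (α_ℓ / (n+1)) ∇B^{n+1}_α`, for `α ∈ cellIdx (n+1)`
(so that `α_ℓ ≥ 1` and the subtraction is a true one). -/
def cellBubble (x : Vertices) (n : ℕ) (ℓ : Fin 4) (α : Fin 4 → ℕ) (p : R3) : R3 :=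
  (((n : ℝ) + 1) * bernstein x n (α - Pi.single ℓ 1) p) • grad (bary x ℓ) p
    - ((α ℓ : ℝ) / ((n : ℝ) + 1)) • grad (bernstein x (n + 1) α) p

/-- The non-curl `H(div)` bubble `Υⁿ_α = (n+1) Bⁿ_α ∑_ℓ (-1)^ℓ α_ℓ χ_ℓ`, for `α ∈ idx n`.
The sum is over `ℓ = 1, …, 4` in one-based numbering, hence the exponent `ℓ + 1` here. -/
def divBubble (x : Vertices) (n : ℕ) (α : Fin 4 → ℕ) (p : R3) : R3 :=
  (((n : ℝ) + 1) * bernstein x n α p) •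
    ∑ ℓ : Fin 4, ((-1 : ℝ) ^ ((ℓ : ℕ) + 1) * (α ℓ : ℝ)) • chi x ℓ p

/-! ### The collection of fields

`n` is the order of the curl part, `m` that of the non-curl bubbles; `a ℓ` is the index left out
on the face opposite to vertex `ℓ`, and `c` the index left out among the non-curl bubbles. -/

/-- The index set of the collection. The five summands are: the lowest order elements, the face
bubbles of the four faces, the cell bubbles with `ℓ = 1, 2`, the cell bubbles with `ℓ = 3` and
`α₃ = 1`, and the non-curl bubbles. -/
abbrev Ind (n m : ℕ) (a : Fin 4 → Fin 4 → ℕ) (c : Fin 4 → ℕ) : Type :=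
  Fin 4
    ⊕ (Σ ℓ : Fin 4, ↥(faceIdx n ℓ \ {a ℓ}))
    ⊕ (Fin 2 × ↥(cellIdx (n + 2)))
    ⊕ ↥{α | α ∈ cellIdx (n + 2) ∧ α 2 = 1}
    ⊕ ↥(idx m \ {c})

/-- The fields of the collection; `e ℓ` lists the vertices of the face opposite to vertex `ℓ`. -/
def family (x : Vertices) (e : Fin 4 → Fin 3 → Fin 4) (n m : ℕ)
    (a : Fin 4 → Fin 4 → ℕ) (c : Fin 4 → ℕ) : Ind n m a c → R3 → R3
  | .inl ℓ => chi x ℓ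
  | .inr (.inl ⟨ℓ, α⟩) => curl (faceBubble x n (e ℓ) α.1)
  | .inr (.inr (.inl (ℓ, α))) => curl (cellBubble x (n + 1) (ℓ.castLE (by decide)) α.1)
  | .inr (.inr (.inr (.inl α))) => curl (cellBubble x (n + 1) 2 α.1)
  | .inr (.inr (.inr (.inr α))) => divBubble x m α.1

/-! ### Polynomial spaces on a set -/

/-- A polynomial in three variables, as a function on `S`. -/
def evalOn (S : Set R3) : MvPolynomial (Fin 3) ℝ →ₗ[ℝ] (S → ℝ) where
  toFun q := fun p => MvPolynomial.eval p.1 q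
  map_add' q r := by ext p; simp
  map_smul' t q := by ext p; simp

/-- `ℙₙ`: the polynomial functions on `S` of total degree at most `n`. -/
def polyOn (S : Set R3) (n : ℕ) : Submodule ℝ (S → ℝ) :=
  (MvPolynomial.restrictTotalDegree (Fin 3) ℝ n).map (evalOn S)

/-- `ℙ̃ₙ`: the homogeneous polynomial functions on `S` of degree `n`. -/
def homPolyOn (S : Set R3) (n : ℕ) : Submodule ℝ (S → ℝ) :=
  (MvPolynomial.homogeneousSubmodule (Fin 3) ℝ n).map (evalOn S)

/-- `ℙₙ³`: the vector fields on `S` with components in `ℙₙ`. -/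
def vecPolyOn (S : Set R3) (n : ℕ) : Submodule ℝ (S → R3) where
  carrier := {v | ∀ i : Fin 3, (fun p => v p i) ∈ polyOn S n}
  add_mem' hv hw i := (polyOn S n).add_mem (hv i) (hw i)
  zero_mem' _ := (polyOn S n).zero_mem
  smul_mem' t _ hv i := (polyOn S n).smul_mem t (hv i)

/-- Multiplication of a scalar function by the position vector, `q ↦ x q`. -/
def mulPos (S : Set R3) : (S → ℝ) →ₗ[ℝ] (S → R3) where
  toFun q := fun p => q p • p.1
  map_add' q r := by ext p i; simp [add_mul]
  map_smul' t q := by ext p i; simp [mul_assoc]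

/-- `x ℙ̃ₙ`. -/
def xHomPolyOn (S : Set R3) (n : ℕ) : Submodule ℝ (S → R3) := (homPolyOn S n).map (mulPos S)

/-- The Raviart–Thomas space `ℙₙ³ + x ℙ̃ₙ`. -/
def raviartThomas (S : Set R3) (n : ℕ) : Submodule ℝ (S → R3) :=
  vecPolyOn S n ⊔ xHomPolyOn S n

end

end BBTet

open BBTet

/-! A vector field `v` is determined by its barycentric components `∇λ_k · v`, which sum to zero. In
these components every field of the collection becomes, up to a nonzero factor, a 4-tuple of
polynomials in the `λ_k`, homogenized by powers of `∑ λ_k = 1`. The fields lie in the target space,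
and their number equals an upper bound for its dimension, so linear independence is all that
remains.

Independence comes from three successive eliminations in a vanishing combination.

Divergence: the curls disappear. Since `χ_ℓ` is a multiple of `x - x_ℓ`, each contributes a
constant. The combination of the `Υ_α` contributes a weighted graph Laplacian of its coefficient
function on the simplex of multi-indices. That Laplacian is therefore constant, while the function
vanishes at the removed index. By the maximum principle (`eq_zero_of_simplexLaplacian_eq_const`)
both the function and the constant are zero, and the `χ_ℓ` left over add up to a constant field.

Normal traces: on a face, the cell bubbles and the bubbles of the other faces give no normal
component, while its own bubbles give again a graph Laplacian, now on the multi-indices of the face.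
It equals a constant coming from the constant field, so the same principle removes that constant and
the face coefficients (`curl_coef_eq_zero`). One removed index per face is exactly what excludes the
constants, which are the kernel of the Laplacian.

Cell bubbles: modulo gradients they are `κ_0 ∇λ_0 + κ_1 ∇λ_1 + κ_2 ∇λ_2`, with coefficients
vanishing near the boundary. Vanishing of the curl gives relations between shifted coefficients; the
restriction `α 2 = 1` on the third kind kills `κ_2` away from `β 2 = 0`, so the other two are
invariant under a shift that pushes them to the boundary (`cellCoef_eq_zero`). -/

namespace BBTet

open scoped Matrix

/-! ### Maximum principle for the graph Laplacian on multi-indices -/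

/-- The graph Laplacian on the multi-indices supported on `s`, whose edges are the moves
`α ↦ α + e_l - e_j`. -/
def simplexLaplacian {ι : Type*} [DecidableEq ι] (s : Finset ι) (q : (ι → ℕ) → ℝ)
    (α : ι → ℕ) : ℝ :=
  ∑ j ∈ s, ∑ l ∈ s,
    ((α j : ℝ) * ((α l : ℝ) + 1)) * (q α - q (α + Pi.single l 1 - Pi.single j 1))

section Laplacian

variable {ι : Type*} [DecidableEq ι] (s : Finset ι)

theorem shift_mem_piAntidiag {m : ℕ} {α : ι → ℕ} (hα : α ∈ s.piAntidiag m)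
    {j l : ι} (hl : l ∈ s) (hj : 0 < α j) :
    α + Pi.single l 1 - Pi.single j 1 ∈ s.piAntidiag m := by
  rw [Finset.mem_piAntidiag] at hα ⊢
  have hjs : j ∈ s := hα.2 j hj.ne'
  refine ⟨?_, fun i hi => ?_⟩
  · have h1 : (α + Pi.single l 1 - Pi.single j 1) + Pi.single j 1 = α + Pi.single l 1 := by
      apply tsub_add_cancel_of_le
      intro i
      by_cases hij : i = j
      · subst hij; simp; omega
      · simp [hij]
    have h2 := congrArg (fun f : ι → ℕ => ∑ i ∈ s, f i) h1
    simp only [Pi.add_apply, Finset.sum_add_distrib, Finset.sum_pi_single', hjs, hl, if_true,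
      hα.1] at h2
    exact Nat.succ_injective h2
  · by_contra his
    apply hi
    have h0 : α i = 0 := by
      by_contra h; exact his (hα.2 i h)
    have : i ≠ l := fun h => his (h ▸ hl)
    simp [h0, this]

theorem exists_maximizer {m : ℕ} {q : (ι → ℕ) → ℝ} {c : ι → ℕ} (hc : c ∈ s.piAntidiag m) :
    ∃ α ∈ s.piAntidiag m, ∀ β ∈ s.piAntidiag m, q β ≤ q α :=
  Finset.exists_max_image _ q ⟨c, hc⟩

theorem simplexLaplacian_nonneg_of_max {m : ℕ} {q : (ι → ℕ) → ℝ} {α : ι → ℕ}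
    (hα : α ∈ s.piAntidiag m) (hmax : ∀ β ∈ s.piAntidiag m, q β ≤ q α) {j l : ι} (hl : l ∈ s) :
    0 ≤ ((α j : ℝ) * ((α l : ℝ) + 1)) * (q α - q (α + Pi.single l 1 - Pi.single j 1)) := by
  rcases Nat.eq_zero_or_pos (α j) with h0 | h0
  · simp [h0]
  · have := hmax _ (shift_mem_piAntidiag s hα hl h0)
    exact mul_nonneg (by positivity) (by linarith)

/-- A subharmonic function attains its maximum at every point. -/
theorem le_of_simplexLaplacian_nonpos {m : ℕ} {q : (ι → ℕ) → ℝ} {c : ι → ℕ}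
    (hc : c ∈ s.piAntidiag m) (h : ∀ α ∈ s.piAntidiag m, simplexLaplacian s q α ≤ 0) :
    ∀ α ∈ s.piAntidiag m, q α ≤ q c := by
  obtain ⟨α₀, hα₀, hmax₀⟩ := exists_maximizer s (q := q) hc
  -- Among the maximizers, take one closest to `c`. The truncated differences add up the excesses of
  -- `α` over `c`, which is half the `ℓ¹` distance because both have total `m`.
  obtain ⟨α, hα, hmin⟩ := Finset.exists_min_image
    ((s.piAntidiag m).filter fun α => q α = q α₀) (fun α => ∑ k ∈ s, (α k - c k))
    ⟨α₀, by simp [hα₀]⟩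
  rw [Finset.mem_filter] at hα
  obtain ⟨hα, hαq⟩ := hα
  have hmax : ∀ β ∈ s.piAntidiag m, q β ≤ q α := fun β hβ => hαq ▸ hmax₀ β hβ
  suffices hαc : α = c by exact fun β hβ => hαc ▸ hmax β hβ
  by_contra hne
  have hα' := Finset.mem_piAntidiag.1 hα
  have hc' := Finset.mem_piAntidiag.1 hc
  have hne' : ∃ i ∈ s, α i ≠ c i := by
    by_contra! hcon
    apply hne
    funext i
    by_cases hi : i ∈ s
    · exact hcon i hi
    · have h1 : α i = 0 := by by_contra h; exact hi (hα'.2 i h)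
      have h2 : c i = 0 := by by_contra h; exact hi (hc'.2 i h)
      rw [h1, h2]
  have hj : ∃ j ∈ s, c j < α j := by
    by_contra! hcon
    obtain ⟨i, hi, hine⟩ := hne'
    have := Finset.sum_lt_sum hcon ⟨i, hi, lt_of_le_of_ne (hcon i hi) hine⟩
    rw [hα'.1, hc'.1] at this
    exact lt_irrefl _ this
  have hl : ∃ l ∈ s, α l < c l := by
    by_contra! hcon
    obtain ⟨i, hi, hine⟩ := hne'
    have := Finset.sum_lt_sum hcon ⟨i, hi, lt_of_le_of_ne (hcon i hi) hine.symm⟩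
    rw [hα'.1, hc'.1] at this
    exact lt_irrefl _ this
  obtain ⟨j, hjs, hj⟩ := hj
  obtain ⟨l, hls, hl⟩ := hl
  have hjl : j ≠ l := by rintro rfl; omega
  have hnn := fun (j' l' : ι) (hl' : l' ∈ s) =>
    simplexLaplacian_nonneg_of_max s hα hmax (j := j') hl'
  -- At a maximum every term of the Laplacian is nonnegative and their sum is nonpositive, so each
  -- vanishes. The neighbour obtained by moving a unit from `j` to `l` is then a maximizer closer to
  -- `c`, a contradiction.
  have hzero : ((α j : ℝ) * ((α l : ℝ) + 1)) *
      (q α - q (α + Pi.single l 1 - Pi.single j 1)) = 0 := by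
    refine le_antisymm ?_ (hnn j l hls)
    refine le_trans ?_ (h α hα)
    refine le_trans ?_ (Finset.single_le_sum
      (f := fun j => ∑ l ∈ s, ((α j : ℝ) * ((α l : ℝ) + 1)) *
        (q α - q (α + Pi.single l 1 - Pi.single j 1)))
      (fun j' _ => Finset.sum_nonneg fun l' hl' => hnn j' l' hl') hjs)
    exact Finset.single_le_sum (f := fun l => ((α j : ℝ) * ((α l : ℝ) + 1)) *
        (q α - q (α + Pi.single l 1 - Pi.single j 1))) (fun l' hl' => hnn j l' hl') hls
  have hpos : (0 : ℝ) < (α j : ℝ) * ((α l : ℝ) + 1) := by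
    have : (0 : ℝ) < α j := by exact_mod_cast (by omega : 0 < α j)
    positivity
  have hq : q (α + Pi.single l 1 - Pi.single j 1) = q α₀ := by
    rcases mul_eq_zero.1 hzero with h | h <;> linarith
  have hmem := shift_mem_piAntidiag s hα hls (show 0 < α j by omega)
  refine absurd (hmin _ (Finset.mem_filter.2 ⟨hmem, hq⟩)) (not_le.2 ?_)
  refine Finset.sum_lt_sum (fun i _ => ?_) ⟨j, hjs, ?_⟩
  · by_cases hil : i = l
    · subst hil; simp; omega
    · simp [hil]; omega
  · simp [hjl]; omega

/-- A function with constant Laplacian that vanishes somewhere is zero, and so is the constant. -/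
theorem eq_zero_of_simplexLaplacian_eq_const {m : ℕ} {q : (ι → ℕ) → ℝ} {c : ι → ℕ}
    (hc : c ∈ s.piAntidiag m) (hqc : q c = 0) {E : ℝ}
    (h : ∀ α ∈ s.piAntidiag m, simplexLaplacian s q α = E) :
    E = 0 ∧ ∀ α ∈ s.piAntidiag m, q α = 0 := by
  have hneg : ∀ α, simplexLaplacian s (-q) α = -simplexLaplacian s q α := by
    intro α
    simp only [simplexLaplacian, ← Finset.sum_neg_distrib, Pi.neg_apply]
    refine Finset.sum_congr rfl fun _ _ => Finset.sum_congr rfl fun _ _ => by ring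
  -- Evaluating at a maximizer gives the sign of the constant; applied to `q` and to `-q`, this
  -- makes it zero.
  have key : ∀ q' : (ι → ℕ) → ℝ, ∀ E' : ℝ,
      (∀ α ∈ s.piAntidiag m, simplexLaplacian s q' α = E') → 0 ≤ E' := by
    intro q' E' h'
    obtain ⟨α, hα, hmax⟩ := exists_maximizer s (q := q') hc
    rw [← h' α hα]
    exact Finset.sum_nonneg fun j _ => Finset.sum_nonneg fun l hl =>
      simplexLaplacian_nonneg_of_max s hα hmax hl
  have hE : E = 0 := by
    have h1 := key q E h
    have h2 := key (-q) (-E) fun α hα => by rw [hneg, h α hα]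
    linarith
  subst hE
  refine ⟨rfl, fun α hα => le_antisymm ?_ ?_⟩
  · have := le_of_simplexLaplacian_nonpos s hc (fun β hβ => (h β hβ).le) α hα
    rwa [hqc] at this
  · have := le_of_simplexLaplacian_nonpos s (q := -q) hc
      (fun β hβ => by rw [hneg, h β hβ, neg_zero]) α hα
    simp only [Pi.neg_apply, hqc] at this
    linarith

end Laplacian

theorem mem_piAntidiag_univ {n : ℕ} {α : Fin 4 → ℕ} :
    α ∈ Finset.univ.piAntidiag n ↔ α ∈ idx n := by
  simp [idx]

theorem mem_piAntidiag_erase {n : ℕ} {k : Fin 4} {α : Fin 4 → ℕ} :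
    α ∈ (Finset.univ.erase k).piAntidiag n ↔ α ∈ faceIdx n k := by
  rw [Finset.mem_piAntidiag]
  simp only [faceIdx, idx, Set.mem_ofPred_eq, Finset.mem_erase, Finset.mem_univ, and_true]
  rw [← Finset.add_sum_erase Finset.univ α (Finset.mem_univ k)]
  constructor
  · rintro ⟨h1, h2⟩
    have h0 : α k = 0 := by by_contra h; exact h2 k h rfl
    exact ⟨by rw [h0, zero_add, h1], h0⟩
  · rintro ⟨h1, h0⟩
    rw [h0, zero_add] at h1
    exact ⟨h1, fun i hi hik => hi (hik ▸ h0)⟩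

/-! ### The alternating tensor of the barycentric gradients -/

/-- The pairings `T k a b = ∇λₖ · (∇λₐ × ∇λ_b)` form an alternating tensor with vanishing
contractions against `(1, 1, 1, 1)`. -/
structure IsVolumeForm (T : Fin 4 → Fin 4 → Fin 4 → ℝ) : Prop where
  swap_right : ∀ k a b, T k a b = -T k b a
  swap_left : ∀ k a b, T k a b = -T a k b
  sum_eq_zero : ∀ a b, ∑ k, T k a b = 0
  ne_zero : ∀ k a b, k ≠ a → k ≠ b → a ≠ b → T k a b ≠ 0

namespace IsVolumeForm

variable {T : Fin 4 → Fin 4 → Fin 4 → ℝ}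

theorem self_right (hT : IsVolumeForm T) (k a : Fin 4) : T k a a = 0 := by
  have := hT.swap_right k a a; linarith

theorem self_left (hT : IsVolumeForm T) (k b : Fin 4) : T k k b = 0 := by
  have := hT.swap_left k k b; linarith

theorem self_outer (hT : IsVolumeForm T) (k a : Fin 4) : T k a k = 0 := by
  rw [hT.swap_right, hT.self_left, neg_zero]

theorem sum_middle (hT : IsVolumeForm T) (k b : Fin 4) : ∑ a, T k a b = 0 := by
  have := hT.sum_eq_zero k b
  rw [← neg_eq_zero, ← Finset.sum_neg_distrib]
  simpa only [← hT.swap_left] using this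

end IsVolumeForm
end BBTet

/-! ### Curls of face and cell bubbles on the level of coefficients -/

namespace BBTet

/-- The coefficients of the `b`-th component of a combination of face bubbles on the face with
vertices `i 0, i 1, i 2`, where `q` lists the coefficients of the combination. -/
def faceCoef (q : (Fin 4 → ℕ) → ℝ) (i : Fin 3 → Fin 4) (b : Fin 4) (β : Fin 4 → ℕ) : ℝ :=
  (if b = i 0 then (β (i 1) : ℝ) * β (i 2) *
      (q (β - Pi.single (i 2) 1) - q (β - Pi.single (i 1) 1)) else 0)
  + (if b = i 1 then (β (i 2) : ℝ) * β (i 0) *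
      (q (β - Pi.single (i 0) 1) - q (β - Pi.single (i 2) 1)) else 0)
  + (if b = i 2 then (β (i 0) : ℝ) * β (i 1) *
      (q (β - Pi.single (i 1) 1) - q (β - Pi.single (i 0) 1)) else 0)

section Face

variable {T : Fin 4 → Fin 4 → Fin 4 → ℝ} {i : Fin 3 → Fin 4} {k : Fin 4}

theorem erase_eq_image (hi : Function.Injective i) (hk : ∀ t, i t ≠ k) :
    Finset.univ.erase k = {i 0, i 1, i 2} := by
  symm
  apply Finset.eq_of_subset_of_card_le
  · intro j hj
    simp only [Finset.mem_insert, Finset.mem_singleton] at hj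
    rcases hj with rfl | rfl | rfl <;> simp [hk]
  · have h01 : i 0 ≠ i 1 := hi.ne (by decide)
    have h02 : i 0 ≠ i 2 := hi.ne (by decide)
    have h12 : i 1 ≠ i 2 := hi.ne (by decide)
    simp [h01, h02, h12]

theorem sum_erase_face (hi : Function.Injective i) (hk : ∀ t, i t ≠ k) (f : Fin 4 → ℝ) :
    ∑ j ∈ Finset.univ.erase k, f j = f (i 0) + f (i 1) + f (i 2) := by
  have h01 : i 0 ≠ i 1 := hi.ne (by decide)
  have h02 : i 0 ≠ i 2 := hi.ne (by decide)
  have h12 : i 1 ≠ i 2 := hi.ne (by decide)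
  rw [erase_eq_image hi hk, Finset.sum_insert (by simp [h01, h02]), Finset.sum_insert (by simp [h12]),
    Finset.sum_singleton, add_assoc]

theorem sum_face (hi : Function.Injective i) (hk : ∀ t, i t ≠ k) (f : Fin 4 → ℝ) :
    ∑ j, f j = f k + (f (i 0) + f (i 1) + f (i 2)) := by
  rw [← Finset.add_sum_erase Finset.univ f (Finset.mem_univ k), sum_erase_face hi hk]

theorem exists_face_eq (hi : Function.Injective i) (hk : ∀ t, i t ≠ k) {j : Fin 4} (hj : j ≠ k) :
    ∃ t, i t = j := by
  have : j ∈ Finset.univ.erase k := by simp [hj]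
  rw [erase_eq_image hi hk] at this
  simp only [Finset.mem_insert, Finset.mem_singleton] at this
  rcases this with rfl | rfl | rfl <;> exact ⟨_, rfl⟩

/-- The normal component of the curl of a face bubble on its own face is a graph Laplacian. -/
theorem curl_faceCoef_self (hT : IsVolumeForm T) (hi : Function.Injective i) (hk : ∀ t, i t ≠ k)
    (q : (Fin 4 → ℕ) → ℝ) (α : Fin 4 → ℕ) :
    ∑ a, ∑ b, T k a b * faceCoef q i b (α + Pi.single a 1) =
      T k (i 0) (i 1) * simplexLaplacian (Finset.univ.erase k) q α := by
  have h01 : i 0 ≠ i 1 := hi.ne (by decide)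
  have h02 : i 0 ≠ i 2 := hi.ne (by decide)
  have h12 : i 1 ≠ i 2 := hi.ne (by decide)
  -- With `k` fixed, the zero row sums and antisymmetry make all entries of `T k` on the face equal
  -- to plus or minus the single number `T k (i 0) (i 1)`, with cyclic signs.
  have s1 := hT.sum_middle k (i 1)
  have s2 := hT.sum_middle k (i 0)
  simp only [sum_face hi hk, hT.self_right, hT.self_left] at s1 s2
  have e1 : T k (i 2) (i 1) = -T k (i 0) (i 1) := by linarith
  have e2 : T k (i 1) (i 0) = -T k (i 0) (i 1) := hT.swap_right _ _ _
  have e3 : T k (i 2) (i 0) = T k (i 0) (i 1) := by linarith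
  have e4 : T k (i 1) (i 2) = T k (i 0) (i 1) := by rw [hT.swap_right, e1, neg_neg]
  have e5 : T k (i 0) (i 2) = -T k (i 0) (i 1) := by rw [hT.swap_right, e3]
  simp only [simplexLaplacian, sum_erase_face hi hk, sum_face hi hk, hT.self_right, hT.self_left,
    hT.self_outer, e1, e2, e3, e4, e5, faceCoef, (hk 0).symm, (hk 1).symm, (hk 2).symm, h01, h02,
    h12, h01.symm, h02.symm, h12.symm, if_true, if_false, Pi.add_apply, Pi.single_eq_same,
    Pi.single_eq_of_ne, ne_eq, not_false_eq_true, add_zero, add_tsub_cancel_right]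
  push_cast
  ring

/-- The normal component of the curl of a face bubble vanishes on the other faces. -/
theorem curl_faceCoef_other (hT : IsVolumeForm T) (hi : Function.Injective i) (hk : ∀ t, i t ≠ k)
    {k' : Fin 4} (hkk : k' ≠ k) (q : (Fin 4 → ℕ) → ℝ) {α : Fin 4 → ℕ} (hα : α k' = 0) :
    ∑ a, ∑ b, T k' a b * faceCoef q i b (α + Pi.single a 1) = 0 := by
  have h01 : i 0 ≠ i 1 := hi.ne (by decide)
  have h02 : i 0 ≠ i 2 := hi.ne (by decide)
  have h12 : i 1 ≠ i 2 := hi.ne (by decide)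
  refine Finset.sum_eq_zero fun a _ => Finset.sum_eq_zero fun b _ => ?_
  by_cases ha : a = k'
  · rw [ha, hT.self_left, zero_mul]
  by_cases hb : b = k'
  · rw [hb, hT.self_outer, zero_mul]
  have h0 : (α + Pi.single a 1 : Fin 4 → ℕ) k' = 0 := by simp [hα, Ne.symm ha]
  -- Now `k'` is a vertex of the face. Every component other than that of `k'` carries the factor `β
  -- k'`, which is zero here.
  obtain ⟨t, rfl⟩ := exists_face_eq hi hk hkk
  fin_cases t <;> simp_all [faceCoef]

/-- Components that vanish on the faces meeting their edge direction do not contribute to the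
normal component of the curl. -/
theorem curl_cellCoef_face (hT : IsVolumeForm T) {κ : Fin 4 → (Fin 4 → ℕ) → ℝ}
    (hκ : ∀ b β k, k ≠ b → β k = 0 → κ b β = 0) {α : Fin 4 → ℕ} (hα : α k = 0) :
    ∑ a, ∑ b, T k a b * κ b (α + Pi.single a 1) = 0 := by
  refine Finset.sum_eq_zero fun a _ => Finset.sum_eq_zero fun b _ => ?_
  by_cases ha : a = k
  · rw [ha, hT.self_left, zero_mul]
  by_cases hb : b = k
  · rw [hb, hT.self_outer, zero_mul]
  rw [hκ b _ k (Ne.symm hb) (by simp [hα, Ne.symm ha]), mul_zero]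

end Face

theorem sub_single_add_single {β : Fin 4 → ℕ} {j : Fin 4} (hj : β j ≠ 0) :
    β - Pi.single j 1 + Pi.single j 1 = β := by
  rw [tsub_add_cancel_of_le]
  intro t
  by_cases ht : t = j
  · subst ht; simp; omega
  · simp [ht]

theorem sub_single_mem_idx {m : ℕ} {β : Fin 4 → ℕ} (hβ : β ∈ idx (m + 1)) {j : Fin 4}
    (hj : β j ≠ 0) : β - Pi.single j 1 ∈ idx m := by
  have e : (β - Pi.single j 1) + Pi.single j 1 = β := sub_single_add_single hj
  have h2 : ∑ t, β t = m + 1 := hβ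
  rw [← e] at h2
  simp only [Pi.add_apply, Finset.sum_add_distrib, Finset.sum_pi_single', Finset.mem_univ,
    if_true] at h2
  exact Nat.succ_injective h2

theorem add_single_mem_idx {m : ℕ} {β : Fin 4 → ℕ} (hβ : β ∈ idx m) (j : Fin 4) :
    β + Pi.single j 1 ∈ idx (m + 1) := by
  have h2 : ∑ s, β s = m := hβ
  change ∑ s, (β + Pi.single j 1 : Fin 4 → ℕ) s = m + 1
  simp only [Pi.add_apply, Finset.sum_add_distrib, Finset.sum_pi_single', Finset.mem_univ,
    if_true, h2]

/-- If a function of multi-indices is invariant under moving a unit from entry `l` to entry `j` and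
vanishes when entry `l` does, then it vanishes. -/
theorem eq_zero_of_shift {n : ℕ} {u : (Fin 4 → ℕ) → ℝ} {j l : Fin 4} (hjl : j ≠ l)
    {P : ℕ → Prop} (hP : ∀ r, P r → P (r + 1))
    (h0 : ∀ β, β l = 0 → u β = 0)
    (h : ∀ α ∈ idx n, P (α j) → u (α + Pi.single l 1) = u (α + Pi.single j 1)) :
    ∀ β ∈ idx (n + 1), P (β j) → u β = 0 := by
  suffices H : ∀ r, ∀ β ∈ idx (n + 1), P (β j) → β l = r → u β = 0 from
    fun β hβ hPβ => H _ β hβ hPβ rfl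
  intro r
  induction r with
  | zero => exact fun β _ _ hr => h0 β hr
  | succ r ih =>
    intro β hβ hPβ hr
    have hl : β l ≠ 0 := by omega
    have hmem : β - Pi.single l 1 ∈ idx n := sub_single_mem_idx hβ hl
    have hj : (β - Pi.single l 1 : Fin 4 → ℕ) j = β j := by simp [hjl]
    rw [← sub_single_add_single hl, h _ hmem (by rwa [hj])]
    apply ih _ (add_single_mem_idx hmem j)
    · simp only [Pi.add_apply, hj, Pi.single_eq_same]; exact hP _ hPβ
    · simp [hjl.symm, hr]

/-- Vanishing of the curl of a combination of cell bubbles forces the coefficients to vanish. -/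
theorem cellCoef_eq_zero {T : Fin 4 → Fin 4 → Fin 4 → ℝ} (hT : IsVolumeForm T)
    {n : ℕ} {κ : Fin 4 → (Fin 4 → ℕ) → ℝ}
    (hκ : ∀ b β k, k ≠ b → β k = 0 → κ b β = 0)
    (h3 : ∀ β, κ 3 β = 0) (h2 : ∀ β, β 2 ≠ 0 → κ 2 β = 0)
    (h : ∀ k, ∀ α ∈ idx n, ∑ a, ∑ b, T k a b * κ b (α + Pi.single a 1) = 0) :
    ∀ b, ∀ β ∈ idx (n + 1), κ b β = 0 := by
  -- As `κ 3 = 0` and the sums of `T k` vanish, the `k`-th component of the curl is `T k i j` times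
  -- one difference of the two sides.
  have hrel : ∀ k i j : Fin 4, k ≠ i → k ≠ j → i ≠ j → k ≠ 3 → i ≠ 3 → j ≠ 3 → ∀ α ∈ idx n,
      κ j (α + Pi.single i 1) - κ j (α + Pi.single 3 1) =
        κ i (α + Pi.single j 1) - κ i (α + Pi.single 3 1) := by
    intro k i j hki hkj hij hk hi hj α hα
    have hinj : Function.Injective ![i, j, 3] := by
      intro s t hst
      fin_cases s <;> fin_cases t <;> simp_all [eq_comm]
    have hne : ∀ t, ![i, j, 3] t ≠ k := by
      intro t
      fin_cases t <;> simp_all [eq_comm]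
    have s1 := hT.sum_middle k i
    have s2 := hT.sum_middle k j
    have e := h k α hα
    simp only [sum_face hinj hne, hT.self_right, hT.self_left, hT.self_outer, Matrix.cons_val,
      h3] at s1 s2 e
    have e1 : T k j i = -T k i j := hT.swap_right _ _ _
    have e2 : T k 3 i = T k i j := by linarith
    have e3 : T k 3 j = -T k i j := by linarith
    rw [e1, e2, e3] at e
    have hne0 := hT.ne_zero k i j hki hkj hij
    apply mul_left_cancel₀ hne0
    linarith
  have hlow : ∀ i j : Fin 4, i ≠ j → i ≠ 2 → j ≠ 2 → i ≠ 3 → j ≠ 3 →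
      ∀ β ∈ idx (n + 1), κ i β = 0 := by
    intro i j hij hi2 hj2 hi3 hj3 β hβ
    by_cases hβ2 : β 2 = 0
    · exact hκ i β 2 (Ne.symm hi2) hβ2
    -- For `α 2 ≠ 0` both `κ 2` terms of the relation vanish, so units of entry 3 move to entry 2
    -- without changing `κ i`, until entry 3 is empty and `κ i` vanishes. Entry 2 never becomes zero
    -- on the way.
    refine eq_zero_of_shift (n := n) (u := κ i) (j := 2) (l := 3) (P := fun r => r ≠ 0) (by decide)
      (fun r _ => by omega) (fun β hβ => hκ i β 3 (Ne.symm hi3) hβ) ?_ β hβ hβ2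
    intro α hα hα2
    have := hrel j i 2 hij.symm hj2 hi2 hj3 hi3 (by decide) α hα
    rw [h2 _ (by simp; omega), h2 _ (by simpa using hα2)] at this
    linarith
  have hk0 : ∀ β ∈ idx (n + 1), κ 0 β = 0 :=
    hlow 0 1 (by decide) (by decide) (by decide) (by decide) (by decide)
  have hk1 : ∀ β ∈ idx (n + 1), κ 1 β = 0 :=
    hlow 1 0 (by decide) (by decide) (by decide) (by decide) (by decide)
  have hk2 : ∀ β ∈ idx (n + 1), κ 2 β = 0 := by
    intro β hβ
    refine eq_zero_of_shift (n := n) (u := κ 2) (j := 0) (l := 3) (P := fun _ => True) (by decide)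
      (fun r _ => trivial) (fun β hβ => hκ 2 β 3 (by decide) hβ) ?_ β hβ trivial
    intro α hα _
    have := hrel 1 0 2 (by decide) (by decide) (by decide) (by decide) (by decide) (by decide) α hα
    rw [hk0 _ (add_single_mem_idx hα 2), hk0 _ (add_single_mem_idx hα 3)] at this
    linarith
  intro b β hβ
  fin_cases b
  · exact hk0 β hβ
  · exact hk1 β hβ
  · exact hk2 β hβ
  · exact h3 β

/-- Independence of the curls of the face and cell bubbles and the constant fields, in terms of
coefficients. -/
theorem curl_coef_eq_zero {T : Fin 4 → Fin 4 → Fin 4 → ℝ} (hT : IsVolumeForm T)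
    {e : Fin 4 → Fin 3 → Fin 4} (he : ∀ ℓ, Function.Injective (e ℓ)) (he' : ∀ ℓ k, e ℓ k ≠ ℓ)
    {n : ℕ} {a : Fin 4 → Fin 4 → ℕ} (ha : ∀ ℓ, a ℓ ∈ faceIdx n ℓ)
    {q : Fin 4 → (Fin 4 → ℕ) → ℝ} (hq : ∀ ℓ, q ℓ (a ℓ) = 0)
    (hq' : ∀ ℓ, ∀ α ∉ faceIdx n ℓ, q ℓ α = 0)
    {κ : Fin 4 → (Fin 4 → ℕ) → ℝ}
    (hκ : ∀ b β k, k ≠ b → β k = 0 → κ b β = 0)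
    (h3 : ∀ β, κ 3 β = 0) (h2 : ∀ β, β 2 ≠ 0 → κ 2 β = 0)
    {d : Fin 4 → ℝ}
    (h : ∀ k, ∀ α ∈ idx n, ∑ a, ∑ b, T k a b *
      (∑ ℓ, faceCoef (q ℓ) (e ℓ) b (α + Pi.single a 1) + κ b (α + Pi.single a 1)) = d k) :
    (∀ k, d k = 0) ∧ (∀ ℓ α, q ℓ α = 0) ∧
      ∀ b, ∀ β ∈ idx (n + 1), κ b β = 0 := by
  have hsplit : ∀ k, ∀ α : Fin 4 → ℕ, ∑ a, ∑ b, T k a b *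
      (∑ ℓ, faceCoef (q ℓ) (e ℓ) b (α + Pi.single a 1) + κ b (α + Pi.single a 1)) =
      ∑ ℓ, ∑ a, ∑ b, T k a b * faceCoef (q ℓ) (e ℓ) b (α + Pi.single a 1) +
        ∑ a, ∑ b, T k a b * κ b (α + Pi.single a 1) := by
    intro k α
    simp only [mul_add, Finset.sum_add_distrib, Finset.mul_sum]
    congr 1
    conv_rhs => rw [Finset.sum_comm]
    refine Finset.sum_congr rfl fun x _ => ?_
    rw [Finset.sum_comm]
  have hface : ∀ k, d k = 0 ∧ ∀ α, q k α = 0 := by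
    intro k
    have hne : T k (e k 0) (e k 1) ≠ 0 :=
      hT.ne_zero _ _ _ (he' k 0).symm (he' k 1).symm ((he k).ne (by decide))
    have := eq_zero_of_simplexLaplacian_eq_const (Finset.univ.erase k) (m := n)
      (q := q k) (c := a k) (mem_piAntidiag_erase.2 (ha k)) (hq k)
      -- Restricting to `α k = 0` isolates the bubbles of face `k`: the cell part and the other
      -- faces drop out.
      (E := (T k (e k 0) (e k 1))⁻¹ * d k) (fun α hα => by
        rw [mem_piAntidiag_erase] at hα
        have h1 := h k α hα.1
        rw [hsplit, curl_cellCoef_face hT hκ hα.2, add_zero, Finset.sum_eq_single k,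
          curl_faceCoef_self hT (he k) (he' k)] at h1
        · rw [← h1, inv_mul_cancel_left₀ hne]
        · intro ℓ _ hℓ
          exact curl_faceCoef_other hT (he ℓ) (he' ℓ) hℓ.symm _ hα.2
        · simp)
    refine ⟨by simpa [hne] using this.1, fun α => ?_⟩
    by_cases hα : α ∈ faceIdx n k
    · exact this.2 α (mem_piAntidiag_erase.2 hα)
    · exact hq' k α hα
  have hq0 : ∀ ℓ, q ℓ = fun _ => 0 := fun ℓ => funext (hface ℓ).2
  refine ⟨fun k => (hface k).1, fun ℓ => (hface ℓ).2, cellCoef_eq_zero hT hκ h3 h2 ?_⟩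
  intro k α hα
  have h1 := h k α hα
  rw [(hface k).1] at h1
  simpa [hq0, faceCoef] using h1

end BBTet

/-! ### Calculus of formal polynomials in the barycentric coordinates -/

namespace BBTet
open MvPolynomial
noncomputable section

/-- The coefficient of `P` at the divided power monomial `X^β / β!`. -/
def dividedCoeff (β : Fin 4 → ℕ) : MvPolynomial (Fin 4) ℝ →ₗ[ℝ] ℝ :=
  (∏ k, ((β k).factorial : ℝ)) • MvPolynomial.lcoeff ℝ (Finsupp.equivFunOnFinite.symm β)

theorem dividedCoeff_apply (β : Fin 4 → ℕ) (P : MvPolynomial (Fin 4) ℝ) :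
    dividedCoeff β P =
      (∏ k, ((β k).factorial : ℝ)) * coeff (Finsupp.equivFunOnFinite.symm β) P := rfl

theorem prod_factorial_add_single (β : Fin 4 → ℕ) (j : Fin 4) :
    ∏ k, (((β + Pi.single j 1 : Fin 4 → ℕ) k).factorial : ℝ) =
      ((β j : ℝ) + 1) * ∏ k, ((β k).factorial : ℝ) := by
  rw [← Finset.mul_prod_erase Finset.univ _ (Finset.mem_univ j),
    ← Finset.mul_prod_erase Finset.univ (fun k => ((β k).factorial : ℝ)) (Finset.mem_univ j),
    ← mul_assoc]
  congr 1
  · simp [Nat.factorial_succ]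
  · refine Finset.prod_congr rfl fun k hk => ?_
    simp [Finset.ne_of_mem_erase hk]

theorem symm_add_single (β : Fin 4 → ℕ) (j : Fin 4) :
    Finsupp.equivFunOnFinite.symm (β + Pi.single j 1) =
      Finsupp.equivFunOnFinite.symm β + Finsupp.single j 1 := by
  ext k
  by_cases h : k = j
  · subst h; simp
  · simp [h]

/-- The factorials in the divided coefficient absorb the exponent produced by differentiation, so a
derivative becomes a pure shift of the multi-index. This turns divergence and curl into difference
operators. -/
theorem dividedCoeff_pderiv (β : Fin 4 → ℕ) (j : Fin 4) (P : MvPolynomial (Fin 4) ℝ) :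
    dividedCoeff β (pderiv j P) = dividedCoeff (β + Pi.single j 1) P := by
  rw [dividedCoeff_apply, dividedCoeff_apply, coeff_pderiv, prod_factorial_add_single,
    symm_add_single]
  simp only [Finsupp.equivFunOnFinite_symm_apply_apply]
  ring

theorem dividedCoeff_X_mul (β : Fin 4 → ℕ) (j : Fin 4) (P : MvPolynomial (Fin 4) ℝ) :
    dividedCoeff β (X j * P) = β j * dividedCoeff (β - Pi.single j 1) P := by
  rcases Nat.eq_zero_or_pos (β j) with h0 | h0
  · rw [dividedCoeff_apply, coeff_X_mul', if_neg (by simp [h0]), h0]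
    simp
  · obtain ⟨γ, rfl⟩ : ∃ γ : Fin 4 → ℕ, β = γ + Pi.single j 1 :=
      ⟨_, (sub_single_add_single h0.ne').symm⟩
    rw [add_tsub_cancel_right, dividedCoeff_apply, dividedCoeff_apply, prod_factorial_add_single,
      symm_add_single, add_comm (Finsupp.equivFunOnFinite.symm γ), coeff_X_mul]
    simp
    ring

/-- The Bernstein polynomial in the barycentric coordinates, as a formal polynomial. -/
def bernsteinPoly (n : ℕ) (α : Fin 4 → ℕ) : MvPolynomial (Fin 4) ℝ :=
  monomial (Finsupp.equivFunOnFinite.symm α) ((n.factorial : ℝ) / ∏ k, ((α k).factorial : ℝ))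

theorem dividedCoeff_bernsteinPoly (n : ℕ) (α β : Fin 4 → ℕ) :
    dividedCoeff β (bernsteinPoly n α) = if β = α then (n.factorial : ℝ) else 0 := by
  rw [dividedCoeff_apply, bernsteinPoly, coeff_monomial]
  simp only [EmbeddingLike.apply_eq_iff_eq, eq_comm (a := α)]
  split_ifs with h
  · subst h
    rw [mul_div_cancel₀]
    exact Finset.prod_ne_zero_iff.2 fun k _ => by exact_mod_cast Nat.factorial_ne_zero _
  · simp

theorem isHomogeneous_bernsteinPoly (n : ℕ) {m : ℕ} {α : Fin 4 → ℕ} (hα : α ∈ idx m) :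
    (bernsteinPoly n α).IsHomogeneous m := by
  apply isHomogeneous_monomial
  rw [Finsupp.degree_eq_sum]
  exact hα

/-- The sum of the variables, which evaluates to `1` at barycentric coordinates. -/
def sumX : MvPolynomial (Fin 4) ℝ := ∑ k, X k

theorem isHomogeneous_sumX_pow (t : ℕ) : (sumX ^ t).IsHomogeneous t := by
  have h : sumX.IsHomogeneous 1 := IsHomogeneous.sum _ _ _ fun k _ => isHomogeneous_X ℝ k
  simpa using h.pow t

theorem pderiv_sumX (k : Fin 4) : pderiv k sumX = 1 := by
  simp [sumX, pderiv_X, Pi.single_apply]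

theorem dividedCoeff_sumX_mul (β : Fin 4 → ℕ) (P : MvPolynomial (Fin 4) ℝ) :
    dividedCoeff β (sumX * P) = ∑ j, (β j : ℝ) * dividedCoeff (β - Pi.single j 1) P := by
  simp [sumX, Finset.sum_mul, dividedCoeff_X_mul]

/-- Constants, once homogenized, become constant functions of the multi-index. This produces the
constant right-hand sides of the Laplace equations. -/
theorem dividedCoeff_sumX_pow {m : ℕ} : ∀ {β : Fin 4 → ℕ}, β ∈ idx m →
    dividedCoeff β (sumX ^ m) = m.factorial := by
  induction m with
  | zero =>
    intro β hβ
    have h0 : β = 0 := by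
      have h2 : ∑ s, β s = 0 := hβ
      funext s
      simpa using (Finset.sum_eq_zero_iff.1 h2) s (Finset.mem_univ s)
    subst h0
    have : (Finsupp.equivFunOnFinite.symm (0 : Fin 4 → ℕ)) = 0 := by ext; simp
    simp [dividedCoeff_apply, this]
  | succ m ih =>
    intro β hβ
    rw [pow_succ', dividedCoeff_sumX_mul]
    have : ∀ j, (β j : ℝ) * dividedCoeff (β - Pi.single j 1) (sumX ^ m) = β j * m.factorial := by
      intro j
      by_cases hj : β j = 0
      · simp [hj]
      · rw [ih (sub_single_mem_idx hβ hj)]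
    have h2 : ∑ s, β s = m + 1 := hβ
    rw [Finset.sum_congr rfl fun j _ => this j, ← Finset.sum_mul, ← Nat.cast_sum, h2,
      Nat.factorial_succ]
    push_cast
    ring

/-- The divergence of a field with barycentric components `w`. -/
def divPoly (w : Fin 4 → MvPolynomial (Fin 4) ℝ) : MvPolynomial (Fin 4) ℝ := ∑ k, pderiv k (w k)

/-- Differentiating the power of `sumX` yields a multiple of `∑ k, w k`, which is zero. Hence the
formal divergence does not depend on the degree of homogenization. -/
theorem divPoly_sumX_pow_mul (t : ℕ) {w : Fin 4 → MvPolynomial (Fin 4) ℝ} (hw : ∑ k, w k = 0) :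
    divPoly (fun k => sumX ^ t * w k) = sumX ^ t * divPoly w := by
  simp only [divPoly, pderiv_mul, pderiv_pow, pderiv_sumX, Finset.sum_add_distrib,
    ← Finset.mul_sum, hw]
  simp

/-- The barycentric components of the curl of the field `∑ b, G b ∇λ_b`. -/
def curlPoly (T : Fin 4 → Fin 4 → Fin 4 → ℝ) (G : Fin 4 → MvPolynomial (Fin 4) ℝ) (k : Fin 4) :
    MvPolynomial (Fin 4) ℝ :=
  ∑ a, ∑ b, T k a b • pderiv a (G b)

theorem curlPoly_add (T : Fin 4 → Fin 4 → Fin 4 → ℝ) (G H : Fin 4 → MvPolynomial (Fin 4) ℝ)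
    (k : Fin 4) : curlPoly T (G + H) k = curlPoly T G k + curlPoly T H k := by
  simp [curlPoly, Finset.sum_add_distrib]

theorem curlPoly_smul (T : Fin 4 → Fin 4 → Fin 4 → ℝ) (r : ℝ) (G : Fin 4 → MvPolynomial (Fin 4) ℝ)
    (k : Fin 4) : curlPoly T (r • G) k = r • curlPoly T G k := by
  simp only [curlPoly, Pi.smul_apply, Derivation.map_smul, Finset.smul_sum]
  refine Finset.sum_congr rfl fun _ _ => Finset.sum_congr rfl fun _ _ => smul_comm _ _ _

theorem curlPoly_sum (T : Fin 4 → Fin 4 → Fin 4 → ℝ) {ι : Type*} (s : Finset ι)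
    (G : ι → Fin 4 → MvPolynomial (Fin 4) ℝ) (k : Fin 4) :
    curlPoly T (∑ i ∈ s, G i) k = ∑ i ∈ s, curlPoly T (G i) k := by
  classical
  induction s using Finset.induction_on with
  | empty => simp [curlPoly]
  | insert i s hi ih => rw [Finset.sum_insert hi, Finset.sum_insert hi, curlPoly_add, ih]

theorem dividedCoeff_curlPoly (T : Fin 4 → Fin 4 → Fin 4 → ℝ)
    (G : Fin 4 → MvPolynomial (Fin 4) ℝ) (k : Fin 4) (α : Fin 4 → ℕ) :
    dividedCoeff α (curlPoly T G k) =
      ∑ a, ∑ b, T k a b * dividedCoeff (α + Pi.single a 1) (G b) := by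
  simp [curlPoly, dividedCoeff_pderiv]

section

variable {T : Fin 4 → Fin 4 → Fin 4 → ℝ}

theorem sum_curlPoly (hT : IsVolumeForm T) (G : Fin 4 → MvPolynomial (Fin 4) ℝ) :
    ∑ k, curlPoly T G k = 0 := by
  simp only [curlPoly]
  rw [Finset.sum_comm]
  refine Finset.sum_eq_zero fun a _ => ?_
  rw [Finset.sum_comm]
  refine Finset.sum_eq_zero fun b _ => ?_
  rw [← Finset.sum_smul, hT.sum_eq_zero, zero_smul]

theorem pderiv_comm (a b : Fin 4) (P : MvPolynomial (Fin 4) ℝ) :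
    pderiv a (pderiv b P) = pderiv b (pderiv a P) := by
  ext m
  simp only [coeff_pderiv, add_right_comm m (Finsupp.single a 1)]
  by_cases h : a = b
  · subst h; rfl
  · simp [h, Ne.symm h]; ring

theorem sum_antisymm {f : Fin 4 → Fin 4 → MvPolynomial (Fin 4) ℝ} (hf : ∀ a b, f a b = -f b a) :
    ∑ a, ∑ b, f a b = 0 := by
  have h : ∑ a, ∑ b, f a b = -∑ a, ∑ b, f a b := by
    conv_lhs => rw [Finset.sum_comm]
    simp only [← Finset.sum_neg_distrib, ← hf]
  exact self_eq_neg.1 h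

theorem divPoly_curlPoly (hT : IsVolumeForm T) (G : Fin 4 → MvPolynomial (Fin 4) ℝ) :
    divPoly (curlPoly T G) = 0 := by
  have h : divPoly (curlPoly T G) = ∑ k, ∑ a, ∑ b, T k a b • pderiv k (pderiv a (G b)) := by
    simp [divPoly, curlPoly]
  rw [h]
  refine sum_antisymm fun k a => ?_
  rw [← Finset.sum_neg_distrib]
  refine Finset.sum_congr rfl fun b _ => ?_
  rw [hT.swap_left, neg_smul, pderiv_comm]

theorem curlPoly_pderiv (hT : IsVolumeForm T) (P : MvPolynomial (Fin 4) ℝ) (k : Fin 4) :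
    curlPoly T (fun b => pderiv b P) k = 0 :=
  sum_antisymm fun a b => by rw [hT.swap_right, neg_smul, pderiv_comm]

end

theorem isHomogeneous_pderiv {n : ℕ} {P : MvPolynomial (Fin 4) ℝ} (hP : P.IsHomogeneous (n + 1))
    (k : Fin 4) : (pderiv k P).IsHomogeneous n := by
  simpa using hP.pderiv (i := k)

theorem isHomogeneous_smul {n : ℕ} {P : MvPolynomial (Fin 4) ℝ} (hP : P.IsHomogeneous n) (r : ℝ) :
    (r • P).IsHomogeneous n :=
  (homogeneousSubmodule (Fin 4) ℝ n).smul_mem r hP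

theorem isHomogeneous_curlPoly (T : Fin 4 → Fin 4 → Fin 4 → ℝ) {n : ℕ}
    {G : Fin 4 → MvPolynomial (Fin 4) ℝ} (hG : ∀ b, (G b).IsHomogeneous (n + 1)) (k : Fin 4) :
    (curlPoly T G k).IsHomogeneous n :=
  IsHomogeneous.sum _ _ _ fun a _ => IsHomogeneous.sum _ _ _ fun b _ =>
    isHomogeneous_smul (isHomogeneous_pderiv (hG b) a) _

/-- The components of the multiple of `x - x_ℓ` to which the face element `χ_ℓ` is equal. -/
def vertexPoly (ℓ k : Fin 4) : MvPolynomial (Fin 4) ℝ := X k - if k = ℓ then sumX else 0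

theorem sum_vertexPoly (ℓ : Fin 4) : ∑ k, vertexPoly ℓ k = 0 := by
  simp [vertexPoly, sumX]

theorem divPoly_vertexPoly (ℓ : Fin 4) : divPoly (vertexPoly ℓ) = 3 := by
  have : ∀ k, pderiv k (vertexPoly ℓ k) = 1 - if k = ℓ then 1 else 0 := by
    intro k
    rw [vertexPoly, map_sub, pderiv_X_self]
    split_ifs
    · rw [pderiv_sumX]
    · simp
  simp [divPoly, this]
  norm_num

theorem isHomogeneous_vertexPoly (ℓ k : Fin 4) : (vertexPoly ℓ k).IsHomogeneous 1 := by
  unfold vertexPoly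
  refine (isHomogeneous_X ℝ k).sub ?_
  split_ifs
  · simpa using isHomogeneous_sumX_pow 1
  · exact isHomogeneous_zero _ _ _

/-- The components of the non-curl bubbles, up to a factor. -/
def bubblePoly (m : ℕ) (α : Fin 4 → ℕ) (k : Fin 4) : MvPolynomial (Fin 4) ℝ :=
  bernsteinPoly m α * ∑ ℓ, (α ℓ : ℝ) • vertexPoly ℓ k

theorem isHomogeneous_bubblePoly {m : ℕ} {α : Fin 4 → ℕ} (hα : α ∈ idx m) (k : Fin 4) :
    (bubblePoly m α k).IsHomogeneous (m + 1) :=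
  (isHomogeneous_bernsteinPoly m hα).mul <| IsHomogeneous.sum _ _ _ fun ℓ _ =>
    isHomogeneous_smul (isHomogeneous_vertexPoly ℓ k) _

/-- The coefficient is nonzero only where `β - e_k = α`, and there `α` and `β` agree in entry `j`.
The weights `α j` of a bubble can thus be replaced by weights in `β`, making a combination of
bubbles depend only on its coefficient function. -/
theorem sub_single_apply_mul_bernsteinPoly (m : ℕ) (α β : Fin 4 → ℕ) (j k : Fin 4) (hjk : j ≠ k) :
    (α j : ℝ) * dividedCoeff (β - Pi.single k 1) (bernsteinPoly m α) =
      β j * dividedCoeff (β - Pi.single k 1) (bernsteinPoly m α) := by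
  rw [dividedCoeff_bernsteinPoly]
  split_ifs with h
  · rw [← h]; simp [hjk]
  · simp

theorem dividedCoeff_bubblePoly (m : ℕ) (α β : Fin 4 → ℕ) (k : Fin 4) :
    dividedCoeff β (bubblePoly m α k) = ∑ j, if j = k then 0 else (β j : ℝ) * β k *
      (dividedCoeff (β - Pi.single k 1) (bernsteinPoly m α) -
        dividedCoeff (β - Pi.single j 1) (bernsteinPoly m α)) := by
  -- Expanding `sumX` gives the antisymmetric form `∑ j, (α j X k - α k X j) B_α`.
  have h1 : bubblePoly m α k = ∑ j, ((α j : ℝ) • (X k * bernsteinPoly m α)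
      - (α k : ℝ) • (X j * bernsteinPoly m α)) := by
    rw [bubblePoly, mul_comm, Finset.sum_mul]
    simp only [vertexPoly, smul_sub, sub_mul, Finset.sum_sub_distrib, smul_mul_assoc, ite_mul,
      smul_ite, smul_zero, Finset.sum_ite_eq, Finset.mem_univ, if_true, zero_mul, sumX,
      Finset.sum_mul, Finset.smul_sum]
  rw [h1, map_sum]
  refine Finset.sum_congr rfl fun j _ => ?_
  split_ifs with hjk
  · subst hjk; simp
  · simp only [map_sub, map_smul, dividedCoeff_X_mul, smul_eq_mul]
    have e1 := sub_single_apply_mul_bernsteinPoly m α β j k hjk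
    have e2 := sub_single_apply_mul_bernsteinPoly m α β k j (Ne.symm hjk)
    linear_combination (β k : ℝ) * e1 - (β j : ℝ) * e2

theorem dividedCoeff_divPoly_bubblePoly (m : ℕ) (α β : Fin 4 → ℕ) :
    dividedCoeff β (divPoly (bubblePoly m α)) =
      simplexLaplacian Finset.univ (fun β => dividedCoeff β (bernsteinPoly m α)) β := by
  simp only [divPoly, map_sum, dividedCoeff_pderiv, dividedCoeff_bubblePoly, simplexLaplacian]
  rw [Finset.sum_comm]
  refine Finset.sum_congr rfl fun j _ => Finset.sum_congr rfl fun k _ => ?_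
  by_cases hjk : j = k
  · subst hjk; simp
  · simp [hjk]

end
end BBTet

/-! ### Formal components of the collection and their independence -/

namespace BBTet
open MvPolynomial
noncomputable section

/-- The components of `ω_{ij}` in terms of the gradients `∇λ_b`. -/
def omegaPoly (i j b : Fin 4) : MvPolynomial (Fin 4) ℝ :=
  (if b = j then X i else 0) - (if b = i then X j else 0)

/-- The components of the face bubbles in terms of the gradients `∇λ_b`. -/
def faceForm (n : ℕ) (i : Fin 3 → Fin 4) (α : Fin 4 → ℕ) (b : Fin 4) : MvPolynomial (Fin 4) ℝ :=
  ((n : ℝ) + 1) • (bernsteinPoly n α * ((α (i 0) : ℝ) • omegaPoly (i 1) (i 2) b +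
    (α (i 1) : ℝ) • omegaPoly (i 2) (i 0) b + (α (i 2) : ℝ) • omegaPoly (i 0) (i 1) b))

/-- The components, up to a gradient, of the cell bubbles in terms of the gradients `∇λ_b`. -/
def cellForm (n : ℕ) (ℓ : Fin 4) (α : Fin 4 → ℕ) (b : Fin 4) : MvPolynomial (Fin 4) ℝ :=
  if b = ℓ then ((n : ℝ) + 2) • bernsteinPoly (n + 1) (α - Pi.single ℓ 1) else 0

theorem dividedCoeff_faceForm (n : ℕ) {i : Fin 3 → Fin 4} (hi : Function.Injective i)
    (α β : Fin 4 → ℕ) (b : Fin 4) :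
    dividedCoeff β (faceForm n i α b) =
      faceCoef (fun β => ((n : ℝ) + 1) * dividedCoeff β (bernsteinPoly n α)) i b β := by
  have h01 : i 0 ≠ i 1 := hi.ne (by decide)
  have h02 : i 0 ≠ i 2 := hi.ne (by decide)
  have h12 : i 1 ≠ i 2 := hi.ne (by decide)
  have key : ∀ (r s : Fin 4), r ≠ s →
      dividedCoeff β (bernsteinPoly n α * ((α r : ℝ) • X s - (α s : ℝ) • X r)) =
      (β r : ℝ) * β s * (dividedCoeff (β - Pi.single s 1) (bernsteinPoly n α) -
        dividedCoeff (β - Pi.single r 1) (bernsteinPoly n α)) := by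
    intro r s hrs
    rw [mul_sub, map_sub, mul_smul_comm, mul_smul_comm, map_smul, map_smul, mul_comm _ (X s),
      mul_comm _ (X r), dividedCoeff_X_mul, dividedCoeff_X_mul, smul_eq_mul, smul_eq_mul]
    have e1 := sub_single_apply_mul_bernsteinPoly n α β r s hrs
    have e2 := sub_single_apply_mul_bernsteinPoly n α β s r (Ne.symm hrs)
    linear_combination (β s : ℝ) * e1 - (β r : ℝ) * e2
  rw [faceForm, map_smul, smul_eq_mul, faceCoef]
  by_cases hb0 : b = i 0
  · subst hb0
    have := key (i 1) (i 2) h12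
    simp only [omegaPoly, h01, h02, if_true, if_false, sub_zero, zero_sub, smul_zero, zero_add,
      add_zero, smul_neg, ← sub_eq_add_neg]
    rw [this]
    ring
  by_cases hb1 : b = i 1
  · subst hb1
    have := key (i 2) (i 0) h02.symm
    simp only [omegaPoly, h01.symm, h12, if_true, if_false, sub_zero, zero_sub, smul_zero, zero_add,
      add_zero, smul_neg, neg_add_eq_sub]
    rw [this]
    ring
  by_cases hb2 : b = i 2
  · subst hb2
    have := key (i 0) (i 1) h01
    simp only [omegaPoly, h02.symm, h12.symm, if_true, if_false, sub_zero, zero_sub, smul_zero,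
      zero_add, add_zero, smul_neg, ← sub_eq_add_neg]
    rw [this]
    ring
  · simp [omegaPoly, hb0, hb1, hb2]

theorem dividedCoeff_cellForm (n : ℕ) (ℓ : Fin 4) (α β : Fin 4 → ℕ) (b : Fin 4) :
    dividedCoeff β (cellForm n ℓ α b) =
      if b = ℓ ∧ β = α - Pi.single ℓ 1 then ((n : ℝ) + 2) * (n + 1).factorial else 0 := by
  rw [cellForm, ite_and]
  split_ifs with h1 h2
  · rw [map_smul, dividedCoeff_bernsteinPoly, if_pos h2, smul_eq_mul]
  · rw [map_smul, dividedCoeff_bernsteinPoly, if_neg h2, smul_zero]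
  · simp

theorem faceCoef_sum {ι : Type*} (s : Finset ι) (r : ι → ℝ) (q : ι → (Fin 4 → ℕ) → ℝ)
    (i : Fin 3 → Fin 4) (b : Fin 4) (β : Fin 4 → ℕ) :
    faceCoef (fun β => ∑ x ∈ s, r x * q x β) i b β = ∑ x ∈ s, r x * faceCoef (q x) i b β := by
  classical
  induction s using Finset.induction_on with
  | empty => simp [faceCoef]
  | insert x s hx ih =>
    rw [Finset.sum_insert hx, ← ih]
    simp only [faceCoef, Finset.sum_insert hx]
    split_ifs <;> ring

theorem isHomogeneous_omegaPoly (i j b : Fin 4) : (omegaPoly i j b).IsHomogeneous 1 := by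
  unfold omegaPoly
  apply IsHomogeneous.sub
  all_goals split_ifs <;> [exact isHomogeneous_X ℝ _; exact isHomogeneous_zero _ _ _]

theorem isHomogeneous_faceForm {n : ℕ} (i : Fin 3 → Fin 4) {α : Fin 4 → ℕ} (hα : α ∈ idx n)
    (b : Fin 4) : (faceForm n i α b).IsHomogeneous (n + 1) :=
  isHomogeneous_smul ((isHomogeneous_bernsteinPoly n hα).mul <|
    ((isHomogeneous_smul (isHomogeneous_omegaPoly _ _ _) _).add
      (isHomogeneous_smul (isHomogeneous_omegaPoly _ _ _) _)).add
      (isHomogeneous_smul (isHomogeneous_omegaPoly _ _ _) _)) _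

theorem isHomogeneous_cellForm {n : ℕ} (ℓ : Fin 4) {α : Fin 4 → ℕ} (hα : α ∈ cellIdx (n + 2))
    (b : Fin 4) : (cellForm n ℓ α b).IsHomogeneous (n + 1) := by
  unfold cellForm
  split_ifs
  · exact isHomogeneous_smul (isHomogeneous_bernsteinPoly _
      (sub_single_mem_idx hα.1 (hα.2 ℓ).ne')) _
  · exact isHomogeneous_zero _ _ _

/-! ### Finiteness of the index sets -/

theorem idx_finite (n : ℕ) : (idx n).Finite :=
  (Finset.univ.piAntidiag n).finite_toSet.subset fun _ hα => mem_piAntidiag_univ.2 hα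

instance (n : ℕ) (ℓ : Fin 4) (b : Fin 4 → ℕ) : Fintype ↥(faceIdx n ℓ \ {b}) :=
  ((idx_finite n).subset fun _ h => h.1.1).fintype

instance (n : ℕ) : Fintype ↥(cellIdx n) :=
  ((idx_finite n).subset fun _ h => h.1).fintype

instance (n : ℕ) : Fintype ↥{α | α ∈ cellIdx n ∧ α 2 = 1} :=
  ((idx_finite n).subset fun _ h => h.1.1).fintype

instance (m : ℕ) (c : Fin 4 → ℕ) : Fintype ↥(idx m \ {c}) :=
  ((idx_finite m).subset fun _ h => h.1).fintype

/-! ### Linear independence -/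

variable {T : Fin 4 → Fin 4 → Fin 4 → ℝ}

theorem sum_smul_eq_zero_of_div (hT : IsVolumeForm T) {m t : ℕ} {c : Fin 4 → ℕ} (hc : c ∈ idx m)
    {d : Fin 4 → ℝ} {G : Fin 4 → MvPolynomial (Fin 4) ℝ} {u : ↥(idx m \ {c}) → ℝ}
    (h : ∀ k, ∑ ℓ, d ℓ • (sumX ^ m * vertexPoly ℓ k) + sumX ^ t * curlPoly T G k +
      ∑ α, u α • bubblePoly m α.1 k = 0) :
    ∑ ℓ, d ℓ = 0 ∧ ∀ α, u α = 0 := by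
  -- Divergence of the relation: `div (x - x_ℓ) = 3`, and curls are divergence free.
  have hdiv : (3 * ∑ ℓ, d ℓ) • sumX ^ m + ∑ α, u α • divPoly (bubblePoly m α.1) = 0 := by
    have h1 : ∑ k, pderiv k (∑ ℓ, d ℓ • (sumX ^ m * vertexPoly ℓ k) + sumX ^ t * curlPoly T G k +
      ∑ α, u α • bubblePoly m α.1 k) = 0 := by simp [h]
    simp only [map_add, map_sum, Derivation.map_smul, Finset.sum_add_distrib] at h1
    rw [Finset.sum_comm, Finset.sum_comm (s := (Finset.univ : Finset (Fin 4)))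
      (t := (Finset.univ : Finset ↥(idx m \ {c})))] at h1
    simp only [← Finset.smul_sum] at h1
    have h2 : ∀ ℓ, ∑ k, pderiv k (sumX ^ m * vertexPoly ℓ k) = (3 : ℝ) • sumX ^ m := by
      intro ℓ
      have := divPoly_sumX_pow_mul m (sum_vertexPoly ℓ)
      rw [divPoly_vertexPoly] at this
      rw [← divPoly, this, smul_eq_C_mul, mul_comm]
      rfl
    have h3 : ∑ k, pderiv k (sumX ^ t * curlPoly T G k) = 0 := by
      have := divPoly_sumX_pow_mul t (sum_curlPoly hT G)
      rwa [divPoly_curlPoly hT, mul_zero] at this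
    rw [Finset.sum_congr rfl fun ℓ _ => by rw [h2 ℓ, smul_smul], h3, add_zero, ← Finset.sum_smul,
      ← Finset.sum_mul, mul_comm] at h1
    exact h1
  have hlap : ∀ β ∈ Finset.univ.piAntidiag m, simplexLaplacian Finset.univ
      (fun β => ∑ α, u α * dividedCoeff β (bernsteinPoly m α.1)) β =
      -(3 * ∑ ℓ, d ℓ) * m.factorial := by
    intro β hβ
    have h1 := congrArg (dividedCoeff β) hdiv
    simp only [map_add, map_sum, map_smul, dividedCoeff_divPoly_bubblePoly, map_zero, smul_eq_mul,
      dividedCoeff_sumX_pow (mem_piAntidiag_univ.1 hβ)] at h1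
    have h2 : simplexLaplacian Finset.univ
      (fun β => ∑ α, u α * dividedCoeff β (bernsteinPoly m α.1)) β =
      ∑ α, u α * simplexLaplacian Finset.univ
        (fun β => dividedCoeff β (bernsteinPoly m α.1)) β := by
      simp only [simplexLaplacian, ← Finset.sum_sub_distrib, Finset.mul_sum]
      conv_rhs => rw [Finset.sum_comm]
      refine Finset.sum_congr rfl fun j _ => ?_
      conv_rhs => rw [Finset.sum_comm]
      refine Finset.sum_congr rfl fun l _ => Finset.sum_congr rfl fun α _ => by ring
    rw [h2]
    linarith
  have hcc : ∑ α : ↥(idx m \ {c}), u α * dividedCoeff c (bernsteinPoly m α.1) = 0 := by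
    refine Finset.sum_eq_zero fun α _ => ?_
    rw [dividedCoeff_bernsteinPoly, if_neg (fun h => α.2.2 h.symm), mul_zero]
  obtain ⟨h0, h1⟩ := eq_zero_of_simplexLaplacian_eq_const Finset.univ
    (mem_piAntidiag_univ.2 hc) hcc hlap
  refine ⟨?_, fun α => ?_⟩
  · have : (m.factorial : ℝ) ≠ 0 := by exact_mod_cast Nat.factorial_ne_zero m
    simpa [this] using h0
  · have := h1 α.1 (mem_piAntidiag_univ.2 α.2.1)
    rw [Finset.sum_eq_single α] at this
    · simpa [dividedCoeff_bernsteinPoly, Nat.factorial_ne_zero] using this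
    · intro β _ hβ
      rw [dividedCoeff_bernsteinPoly, if_neg (fun h => hβ (Subtype.ext h.symm)), mul_zero]
    · simp

/-- When the weights sum to zero, `∑ d_ℓ (x - x_ℓ)` loses its linear part and is the constant field
with components `-d_k`. -/
theorem sum_smul_vertexPoly {m : ℕ} {d : Fin 4 → ℝ} (hd : ∑ ℓ, d ℓ = 0) (k : Fin 4) :
    ∑ ℓ, d ℓ • (sumX ^ m * vertexPoly ℓ k) = -(d k • sumX ^ (m + 1)) := by
  simp only [vertexPoly, mul_sub, smul_sub, Finset.sum_sub_distrib, ← Finset.sum_smul, hd, zero_smul,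
    mul_ite, mul_zero, smul_ite, smul_zero, Finset.sum_ite_eq, Finset.mem_univ, if_true, zero_sub,
    pow_succ]

theorem sumX_ne_zero : sumX ≠ 0 := by
  intro h
  have := congrArg (pderiv 0) h
  rw [pderiv_sumX] at this
  simp at this

/-- The barycentric components, up to a scalar factor and homogenized, of the fields of the
collection. -/
def polyFamily (T : Fin 4 → Fin 4 → Fin 4 → ℝ) (e : Fin 4 → Fin 3 → Fin 4) (n m t : ℕ)
    (a : Fin 4 → Fin 4 → ℕ) (c : Fin 4 → ℕ) : Ind n m a c → Fin 4 → MvPolynomial (Fin 4) ℝ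
  | .inl ℓ => fun k => sumX ^ m * vertexPoly ℓ k
  | .inr (.inl ⟨ℓ, α⟩) => fun k => sumX ^ t * curlPoly T (faceForm n (e ℓ) α.1) k
  | .inr (.inr (.inl (ℓ, α))) =>
      fun k => sumX ^ t * curlPoly T (cellForm n (ℓ.castLE (by decide)) α.1) k
  | .inr (.inr (.inr (.inl α))) => fun k => sumX ^ t * curlPoly T (cellForm n 2 α.1) k
  | .inr (.inr (.inr (.inr α))) => bubblePoly m α.1

theorem isHomogeneous_polyFamily (T : Fin 4 → Fin 4 → Fin 4 → ℝ) (e : Fin 4 → Fin 3 → Fin 4)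
    {n m t : ℕ} (hmt : m + 1 = t + n) (a : Fin 4 → Fin 4 → ℕ) (c : Fin 4 → ℕ) (i : Ind n m a c)
    (k : Fin 4) : (polyFamily T e n m t a c i k).IsHomogeneous (m + 1) := by
  rcases i with ℓ | ⟨ℓ, α⟩ | ⟨ℓ, α⟩ | α | α
  · exact (isHomogeneous_sumX_pow m).mul (isHomogeneous_vertexPoly ℓ k)
  · rw [hmt]
    exact (isHomogeneous_sumX_pow t).mul (isHomogeneous_curlPoly T
      (isHomogeneous_faceForm _ α.2.1.1) k)
  · rw [hmt]
    exact (isHomogeneous_sumX_pow t).mul (isHomogeneous_curlPoly T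
      (isHomogeneous_cellForm _ α.2) k)
  · rw [hmt]
    exact (isHomogeneous_sumX_pow t).mul (isHomogeneous_curlPoly T
      (isHomogeneous_cellForm _ α.2.1) k)
  · exact isHomogeneous_bubblePoly α.2.1 k

/-- The exponent `t` brings the curls, of degree `n`, to the common degree `m + 1`: it is 1 for
Raviart–Thomas and 0 for BDM. -/
theorem polyFamily_independent (hT : IsVolumeForm T)
    {e : Fin 4 → Fin 3 → Fin 4} (he : ∀ ℓ, Function.Injective (e ℓ)) (he' : ∀ ℓ k, e ℓ k ≠ ℓ)
    {n m t : ℕ} (hmt : m + 1 = t + n) {a : Fin 4 → Fin 4 → ℕ} (ha : ∀ ℓ, a ℓ ∈ faceIdx n ℓ)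
    {c : Fin 4 → ℕ} (hc : c ∈ idx m) {r : Ind n m a c → ℝ}
    (h : ∀ k, ∑ i, r i • polyFamily T e n m t a c i k = 0) : ∀ i, r i = 0 := by
  set d : Fin 4 → ℝ := fun ℓ => r (.inl ℓ) with hd
  set f : (ℓ : Fin 4) → ↥(faceIdx n ℓ \ {a ℓ}) → ℝ := fun ℓ α => r (.inr (.inl ⟨ℓ, α⟩)) with hf
  set g : Fin 2 → ↥(cellIdx (n + 2)) → ℝ := fun ℓ α => r (.inr (.inr (.inl (ℓ, α)))) with hg
  set g₃ : ↥{α | α ∈ cellIdx (n + 2) ∧ α 2 = 1} → ℝ :=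
    fun α => r (.inr (.inr (.inr (.inl α)))) with hg₃
  set u : ↥(idx m \ {c}) → ℝ := fun α => r (.inr (.inr (.inr (.inr α)))) with hu
  set K : Fin 4 → MvPolynomial (Fin 4) ℝ :=
    ∑ ℓ : Fin 2, ∑ α, g ℓ α • cellForm n (ℓ.castLE (by decide)) α.1 +
      ∑ α, g₃ α • cellForm n 2 α.1 with hK
  set G : Fin 4 → MvPolynomial (Fin 4) ℝ :=
    ∑ ℓ, ∑ α, f ℓ α • faceForm n (e ℓ) α.1 + K with hG
  have hG' : ∀ k, curlPoly T G k = ∑ ℓ, ∑ α, f ℓ α • curlPoly T (faceForm n (e ℓ) α.1) k +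
      (∑ ℓ : Fin 2, ∑ α, g ℓ α • curlPoly T (cellForm n (ℓ.castLE (by decide)) α.1) k +
        ∑ α, g₃ α • curlPoly T (cellForm n 2 α.1) k) := by
    intro k
    simp only [hG, hK, curlPoly_add, curlPoly_sum, curlPoly_smul]
  have h' : ∀ k, ∑ ℓ, d ℓ • (sumX ^ m * vertexPoly ℓ k) + sumX ^ t * curlPoly T G k +
      ∑ α, u α • bubblePoly m α.1 k = 0 := by
    intro k
    rw [← h k, hG']
    simp only [Fintype.sum_sum_type, Fintype.sum_sigma, Fintype.sum_prod_type, polyFamily,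
      mul_add, Finset.mul_sum, mul_smul_comm, hd, hf, hg, hg₃, hu]
    simp only [add_assoc]
  obtain ⟨hd0, hu0⟩ := sum_smul_eq_zero_of_div hT hc h'
  have hcurl : ∀ k, curlPoly T G k = d k • sumX ^ n := by
    intro k
    have h1 := h' k
    rw [sum_smul_vertexPoly hd0, Finset.sum_eq_zero fun α _ => by rw [hu0 α, zero_smul],
      add_zero, neg_add_eq_zero, hmt, pow_add, ← mul_smul_comm] at h1
    exact (mul_left_cancel₀ (pow_ne_zero t sumX_ne_zero) h1).symm
  have hnf : ((n : ℝ) + 1) * n.factorial ≠ 0 :=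
    mul_ne_zero (by positivity) (by exact_mod_cast Nat.factorial_ne_zero n)
  have hnf' : ((n : ℝ) + 2) * (n + 1).factorial ≠ 0 :=
    mul_ne_zero (by positivity) (by exact_mod_cast Nat.factorial_ne_zero _)
  set q : Fin 4 → (Fin 4 → ℕ) → ℝ := fun ℓ β =>
    ∑ α, f ℓ α * (((n : ℝ) + 1) * dividedCoeff β (bernsteinPoly n α.1)) with hq
  set κ : Fin 4 → (Fin 4 → ℕ) → ℝ := fun b β => dividedCoeff β (K b) with hκ
  have hκ' : ∀ b β, κ b β =
      ∑ ℓ : Fin 2, ∑ α : ↥(cellIdx (n + 2)), g ℓ α * (if b = ℓ.castLE (by decide) ∧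
        β = α.1 - Pi.single (ℓ.castLE (by decide)) 1 then ((n : ℝ) + 2) * (n + 1).factorial
          else 0) +
      ∑ α : ↥{α | α ∈ cellIdx (n + 2) ∧ α 2 = 1}, g₃ α * (if b = 2 ∧ β = α.1 - Pi.single 2 1 then
        ((n : ℝ) + 2) * (n + 1).factorial else 0) := by
    intro b β
    simp only [hκ, hK, Pi.add_apply, Finset.sum_apply, Pi.smul_apply, map_add, map_sum, map_smul,
      dividedCoeff_cellForm, smul_eq_mul]
  have key := curl_coef_eq_zero hT he he' ha (q := q) (κ := κ) (d := fun k => d k * n.factorial)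
    (fun ℓ => Finset.sum_eq_zero fun α _ => by
      rw [dividedCoeff_bernsteinPoly, if_neg (fun h => α.2.2 h.symm), mul_zero, mul_zero])
    (fun ℓ β hβ => Finset.sum_eq_zero fun α _ => by
      rw [dividedCoeff_bernsteinPoly, if_neg (fun h : β = α.1 => hβ (h ▸ α.2.1)), mul_zero, mul_zero])
    -- The entries of `α` are positive, and `β = α - e_b` differs from `α` only in entry `b`.
    (fun b β k hkb hβk => by
      rw [hκ', Finset.sum_eq_zero, Finset.sum_eq_zero, add_zero]
      · intro α _
        rw [if_neg, mul_zero]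
        rintro ⟨rfl, rfl⟩
        have := α.2.1.2 k
        simp [hkb] at hβk
        omega
      · intro ℓ _
        refine Finset.sum_eq_zero fun α _ => ?_
        rw [if_neg, mul_zero]
        rintro ⟨rfl, rfl⟩
        have := α.2.2 k
        simp [hkb] at hβk
        omega)
    (fun β => by
      rw [hκ', Finset.sum_eq_zero, Finset.sum_eq_zero, add_zero]
      · intro α _
        rw [if_neg (by simp), mul_zero]
      · intro ℓ _
        refine Finset.sum_eq_zero fun α _ => ?_
        rw [if_neg, mul_zero]
        rintro ⟨h3, -⟩
        have := congrArg Fin.val h3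
        simp at this
        omega)
    -- The condition `α 2 = 1` places the third kind of cell bubbles at `β 2 = 0`.
    (fun β hβ => by
      rw [hκ', Finset.sum_eq_zero, Finset.sum_eq_zero, add_zero]
      · intro α _
        rw [if_neg, mul_zero]
        rintro ⟨-, rfl⟩
        simp [α.2.2] at hβ
      · intro ℓ _
        refine Finset.sum_eq_zero fun α _ => ?_
        rw [if_neg, mul_zero]
        rintro ⟨h3, -⟩
        have := congrArg Fin.val h3
        simp at this
        omega)
    (fun k α hα => by
      have h1 := congrArg (dividedCoeff α) (hcurl k)
      rw [dividedCoeff_curlPoly, map_smul, dividedCoeff_sumX_pow hα, smul_eq_mul] at h1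
      rw [← h1]
      refine Finset.sum_congr rfl fun a' _ => Finset.sum_congr rfl fun b _ => ?_
      congr 1
      simp only [hG, hκ, Pi.add_apply, Finset.sum_apply, Pi.smul_apply, map_add, map_sum, map_smul,
        smul_eq_mul, hq, faceCoef_sum]
      congr 1
      refine Finset.sum_congr rfl fun ℓ _ => Finset.sum_congr rfl fun α' _ => ?_
      rw [dividedCoeff_faceForm n (he ℓ)])
  obtain ⟨hd1, hq1, hκ1⟩ := key
  have hn0 : (n.factorial : ℝ) ≠ 0 := by exact_mod_cast Nat.factorial_ne_zero n
  have hinj : ∀ (ℓ : Fin 4) {α β : Fin 4 → ℕ}, α ∈ cellIdx (n + 2) → β ∈ cellIdx (n + 2) →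
      α - Pi.single ℓ 1 = β - Pi.single ℓ 1 → α = β := by
    intro ℓ α β hα hβ hαβ
    funext s
    have h1 := congrFun hαβ s
    have h2 := hα.2 s
    have h3 := hβ.2 s
    by_cases hs : s = ℓ
    · subst hs; simp at h1; omega
    · simpa [hs] using h1
  rintro (ℓ | ⟨ℓ, α⟩ | ⟨ℓ, α⟩ | α | α)
  · simpa [hn0] using hd1 ℓ
  · have h1 := hq1 ℓ α.1
    simp only [hq] at h1
    rw [Finset.sum_eq_single α] at h1
    · rw [dividedCoeff_bernsteinPoly, if_pos rfl] at h1
      exact (mul_eq_zero.1 h1).resolve_right hnf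
    · intro β _ hβ
      rw [dividedCoeff_bernsteinPoly, if_neg (fun h => hβ (Subtype.ext h.symm)), mul_zero, mul_zero]
    · simp
  · have h1 := hκ1 (ℓ.castLE (by decide)) (α.1 - Pi.single (ℓ.castLE (by decide)) 1)
      (sub_single_mem_idx α.2.1 (α.2.2 _).ne')
    rw [hκ', Finset.sum_eq_single ℓ, Finset.sum_eq_single α, Finset.sum_eq_zero, add_zero,
      if_pos ⟨rfl, rfl⟩] at h1
    · exact (mul_eq_zero.1 h1).resolve_right hnf'
    · intro β _
      rw [if_neg, mul_zero]
      rintro ⟨h3, -⟩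
      have := congrArg Fin.val h3
      simp at this
      omega
    · intro β _ hβ
      rw [if_neg, mul_zero]
      rintro ⟨-, h3⟩
      exact hβ (Subtype.ext (hinj _ β.2 α.2 h3.symm))
    · simp
    · intro ℓ' _ hℓ'
      refine Finset.sum_eq_zero fun β _ => ?_
      rw [if_neg, mul_zero]
      rintro ⟨h3, -⟩
      exact hℓ' (Fin.castLE_injective _ h3.symm)
    · simp
  · have h1 := hκ1 2 (α.1 - Pi.single 2 1) (sub_single_mem_idx α.2.1.1 (α.2.1.2 _).ne')
    rw [hκ', Finset.sum_eq_zero, zero_add, Finset.sum_eq_single α, if_pos ⟨rfl, rfl⟩] at h1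
    · exact (mul_eq_zero.1 h1).resolve_right hnf'
    · intro β _ hβ
      rw [if_neg, mul_zero]
      rintro ⟨-, h3⟩
      exact hβ (Subtype.ext (hinj _ β.2.1 α.2.1 h3.symm))
    · simp
    · intro ℓ' _
      refine Finset.sum_eq_zero fun β _ => ?_
      rw [if_neg, mul_zero]
      rintro ⟨h3, -⟩
      have := congrArg Fin.val h3
      simp at this
      omega
  · exact hu0 α

end
end BBTet

/-! ### From vector fields to formal barycentric components -/

namespace BBTet
open MvPolynomial
open scoped Matrix
noncomputable section

variable (x : Vertices)

/-- The constant gradient `∇λₖ`. -/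
def baryGrad (k : Fin 4) : R3 := fun i => (x.coord k).linear (Pi.single i 1)

theorem linear_eq_dotProduct (k : Fin 4) (v : R3) : (x.coord k).linear v = baryGrad x k ⬝ᵥ v := by
  conv_lhs => rw [← Finset.univ_sum_single v]
  rw [map_sum, dotProduct]
  refine Finset.sum_congr rfl fun i _ => ?_
  have : (Pi.single i (v i) : R3) = v i • Pi.single i 1 := by
    rw [← Pi.single_smul', smul_eq_mul, mul_one]
  rw [this, map_smul, smul_eq_mul, mul_comm, baryGrad]

theorem bary_add (k : Fin 4) (p v : R3) : bary x k (v + p) = baryGrad x k ⬝ᵥ v + bary x k p := by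
  have := (x.coord k).map_vadd p v
  rwa [linear_eq_dotProduct] at this

theorem sum_bary (p : R3) : ∑ k, bary x k p = 1 := x.sum_coord_apply_eq_one p

theorem sum_bary_smul (p : R3) : ∑ k, bary x k p • x k = p := x.linear_combination_coord_eq_self p

theorem sum_baryGrad_dotProduct (v : R3) : ∑ k, baryGrad x k ⬝ᵥ v = 0 := by
  have h := sum_bary x (v + 0)
  simp only [bary_add, Finset.sum_add_distrib, sum_bary] at h
  linarith

theorem sum_baryGrad_smul (v : R3) : ∑ k, (baryGrad x k ⬝ᵥ v) • x k = v := by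
  have h := sum_bary_smul x (v + 0)
  simp only [bary_add, add_smul, Finset.sum_add_distrib, sum_bary_smul] at h
  simpa using h

theorem baryGrad_ext {v w : R3} (h : ∀ k, baryGrad x k ⬝ᵥ v = baryGrad x k ⬝ᵥ w) : v = w := by
  rw [← sum_baryGrad_smul x v, ← sum_baryGrad_smul x w]
  simp only [h]

theorem baryGrad_dotProduct_sub_vertex (k ℓ : Fin 4) (p : R3) :
    baryGrad x k ⬝ᵥ (p - x ℓ) = bary x k p - if k = ℓ then 1 else 0 := by
  have h := bary_add x k (x ℓ) (p - x ℓ)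
  rw [sub_add_cancel] at h
  rw [h]
  simp [bary, AffineBasis.coord_apply]

/-- The trilinear pairings of the gradients of the barycentric coordinates. -/
def gradVol (k a b : Fin 4) : ℝ := baryGrad x k ⬝ᵥ (baryGrad x a ⨯₃ baryGrad x b)

theorem isVolumeForm_gradVol : IsVolumeForm (gradVol x) where
  swap_right k a b := by
    rw [gradVol, gradVol, ← cross_anticomm, dotProduct_neg]
  swap_left k a b := by
    rw [gradVol, gradVol, triple_product_permutation, ← cross_anticomm, dotProduct_neg,
      triple_product_permutation (baryGrad x a), ← cross_anticomm, dotProduct_neg, neg_neg,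
      triple_product_permutation, ← cross_anticomm, dotProduct_neg]
  sum_eq_zero a b := sum_baryGrad_dotProduct x _
  ne_zero k a b hka hkb hab := by
    rw [gradVol, triple_product_eq_det]
    intro h0
    obtain ⟨v, hv, hMv⟩ := Matrix.exists_mulVec_eq_zero_iff.2 h0
    have hk : baryGrad x k ⬝ᵥ v = 0 := congrFun hMv 0
    have ha : baryGrad x a ⬝ᵥ v = 0 := congrFun hMv 1
    have hb : baryGrad x b ⬝ᵥ v = 0 := congrFun hMv 2
    -- A vector orthogonal to three of the gradients is orthogonal to the fourth, as they sum to
    -- zero; all its components vanish, and so does the vector.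
    obtain ⟨l, hlk, hla, hlb⟩ : ∃ l : Fin 4, k ≠ l ∧ a ≠ l ∧ b ≠ l := by
      clear hk ha hb hMv hv h0
      revert k a b
      decide
    have hinj : Function.Injective ![k, a, b] := by
      intro s t hst
      fin_cases s <;> fin_cases t <;> simp_all [eq_comm]
    have hne : ∀ t, ![k, a, b] t ≠ l := by
      intro t
      fin_cases t <;> simp_all
    have hl := sum_baryGrad_dotProduct x v
    rw [sum_face hinj hne] at hl
    simp only [Matrix.cons_val, hk, ha, hb, add_zero] at hl
    refine hv (baryGrad_ext x fun s => ?_)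
    rw [dotProduct_zero]
    by_cases hs : s = l
    · rw [hs, hl]
    · obtain ⟨t, rfl⟩ := exists_face_eq hinj hne hs
      fin_cases t
      exacts [hk, ha, hb]

/-- Evaluation of a formal polynomial at the barycentric coordinates. -/
def evalBary (P : MvPolynomial (Fin 4) ℝ) (p : R3) : ℝ := eval (fun k => bary x k p) P

theorem evalBary_bernsteinPoly (n : ℕ) (α : Fin 4 → ℕ) (p : R3) :
    evalBary x (bernsteinPoly n α) p = bernstein x n α p := by
  rw [evalBary, bernsteinPoly, eval_monomial, bernstein, Finsupp.prod_fintype _ _ (by simp)]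
  simp

theorem evalBary_sumX (p : R3) : evalBary x sumX p = 1 := by
  simp [evalBary, sumX, sum_bary]

theorem evalBary_sumX_pow_mul (t : ℕ) (P : MvPolynomial (Fin 4) ℝ) (p : R3) :
    evalBary x (sumX ^ t * P) p = evalBary x P p := by
  have := evalBary_sumX x p
  unfold evalBary at this ⊢
  simp [this]

theorem hasFDerivAt_bary (k : Fin 4) (p : R3) :
    HasFDerivAt (bary x k) (LinearMap.toContinuousLinearMap (x.coord k).linear) p := by
  have h : bary x k = fun q => LinearMap.toContinuousLinearMap (x.coord k).linear q + bary x k 0 := by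
    funext q
    have := bary_add x k 0 q
    rw [add_zero] at this
    rw [this, LinearMap.coe_toContinuousLinearMap', linear_eq_dotProduct]
  rw [h]
  exact (ContinuousLinearMap.hasFDerivAt _).add_const _

theorem grad_bary (k : Fin 4) (p : R3) : grad (bary x k) p = baryGrad x k := by
  funext i
  rw [grad, pd, (hasFDerivAt_bary x k p).fderiv]
  rfl

theorem hasFDerivAt_evalBary (P : MvPolynomial (Fin 4) ℝ) (p : R3) :
    HasFDerivAt (evalBary x P) (∑ k, evalBary x (pderiv k P) p •
      LinearMap.toContinuousLinearMap (x.coord k).linear) p := by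
  induction P using MvPolynomial.induction_on with
  | C r =>
    have : evalBary x (C r) = fun _ => r := by funext q; simp [evalBary]
    rw [this]
    simpa [evalBary] using hasFDerivAt_const r p
  | add P Q hP hQ =>
    have : evalBary x (P + Q) = fun q => evalBary x P q + evalBary x Q q := by
      funext q; simp [evalBary]
    rw [this]
    refine (hP.add hQ).congr_fderiv ?_
    rw [← Finset.sum_add_distrib]
    refine Finset.sum_congr rfl fun k _ => ?_
    rw [← add_smul]
    simp [evalBary]
  | mul_X P j hP =>
    have : evalBary x (P * X j) = fun q => evalBary x P q * bary x j q := by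
      funext q; simp [evalBary]
    rw [this]
    refine (hP.mul (hasFDerivAt_bary x j p)).congr_fderiv ?_
    rw [Finset.smul_sum]
    have : ∀ k, evalBary x (pderiv k (P * X j)) p =
        (if k = j then evalBary x P p else 0) + bary x j p * evalBary x (pderiv k P) p := by
      intro k
      rw [pderiv_mul, pderiv_X]
      by_cases hk : k = j
      · subst hk
        simp [evalBary]; ring
      · simp [evalBary, hk, Ne.symm hk]; ring
    simp only [this, add_smul, ite_smul, zero_smul, Finset.sum_add_distrib, Finset.sum_ite_eq',
      Finset.mem_univ, if_true, mul_smul]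

theorem pd_evalBary (P : MvPolynomial (Fin 4) ℝ) (i : Fin 3) (p : R3) :
    pd i (evalBary x P) p = ∑ k, evalBary x (pderiv k P) p * baryGrad x k i := by
  rw [pd, (hasFDerivAt_evalBary x P p).fderiv]
  simp [baryGrad]

theorem grad_evalBary (P : MvPolynomial (Fin 4) ℝ) (p : R3) :
    grad (evalBary x P) p = ∑ k, evalBary x (pderiv k P) p • baryGrad x k := by
  funext i
  simp [grad, pd_evalBary]

/-- The vector field `∑ b, G b ∇λ_b`. -/
def formField (G : Fin 4 → MvPolynomial (Fin 4) ℝ) (p : R3) : R3 :=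
  ∑ b, evalBary x (G b) p • baryGrad x b

theorem pd_formField (G : Fin 4 → MvPolynomial (Fin 4) ℝ) (i j : Fin 3) (p : R3) :
    pd i (fun q => formField x G q j) p =
      ∑ b, ∑ a, evalBary x (pderiv a (G b)) p * baryGrad x a i * baryGrad x b j := by
  have h : HasFDerivAt (fun q => formField x G q j) (∑ b, baryGrad x b j •
      ∑ k, evalBary x (pderiv k (G b)) p •
      LinearMap.toContinuousLinearMap (x.coord k).linear) p := by
    simp only [formField, Finset.sum_apply, Pi.smul_apply, smul_eq_mul]
    exact HasFDerivAt.fun_sum fun b _ => (hasFDerivAt_evalBary x (G b) p).mul_const _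
  rw [pd, h.fderiv]
  simp only [sum_apply, smul_apply,
    LinearMap.coe_toContinuousLinearMap', smul_eq_mul, Finset.mul_sum]
  refine Finset.sum_congr rfl fun b _ => Finset.sum_congr rfl fun a _ => ?_
  rw [baryGrad, baryGrad]
  ring

theorem curl_formField (G : Fin 4 → MvPolynomial (Fin 4) ℝ) (p : R3) :
    curl (formField x G) p =
      ∑ a, ∑ b, evalBary x (pderiv a (G b)) p • (baryGrad x a ⨯₃ baryGrad x b) := by
  rw [Finset.sum_comm]
  funext i
  simp only [curl, pd_formField, Finset.sum_apply, Pi.smul_apply, smul_eq_mul,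
    ← Finset.sum_sub_distrib, cross_apply]
  fin_cases i <;>
  · simp only [Fin.zero_eta, Fin.mk_one, Fin.reduceFinMk, Matrix.cons_val]
    refine Finset.sum_congr rfl fun b _ => Finset.sum_congr rfl fun a _ => ?_
    ring

theorem baryGrad_dotProduct_curl_formField (G : Fin 4 → MvPolynomial (Fin 4) ℝ) (k : Fin 4)
    (p : R3) :
    baryGrad x k ⬝ᵥ curl (formField x G) p = evalBary x (curlPoly (gradVol x) G k) p := by
  rw [curl_formField]
  simp only [dotProduct_sum, dotProduct_smul, curlPoly, evalBary, map_sum, smul_eval,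
    smul_eq_mul, gradVol]
  refine Finset.sum_congr rfl fun a _ => Finset.sum_congr rfl fun b _ => mul_comm _ _

theorem omega_eq_formField (i j : Fin 4) (p : R3) :
    omega x i j p = formField x (omegaPoly i j) p := by
  simp only [omega, grad_bary, formField, omegaPoly, evalBary, map_sub, apply_ite (eval _), eval_X,
    map_zero, sub_smul, Finset.sum_sub_distrib, ite_smul, zero_smul, Finset.sum_ite_eq',
    Finset.mem_univ, if_true]

theorem faceBubble_eq_formField (n : ℕ) (i : Fin 3 → Fin 4) (α : Fin 4 → ℕ) :
    faceBubble x n i α = formField x (faceForm n i α) := by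
  funext p
  rw [faceBubble]
  simp only [omega_eq_formField, formField, Finset.smul_sum, ← Finset.sum_add_distrib,
    ← evalBary_bernsteinPoly]
  refine Finset.sum_congr rfl fun b _ => ?_
  simp only [← add_smul, smul_smul]
  congr 1
  simp [evalBary, faceForm]
  ring

/-- The second summand is a gradient, so it disappears from the curl and only `cellForm` matters. -/
theorem cellBubble_eq_formField (n : ℕ) (ℓ : Fin 4) (α : Fin 4 → ℕ) :
    cellBubble x (n + 1) ℓ α = formField x (cellForm n ℓ α +
      (-((α ℓ : ℝ) / ((n : ℝ) + 2))) • fun b => pderiv b (bernsteinPoly (n + 2) α)) := by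
  funext p
  have h : bernstein x (n + 1 + 1) α = evalBary x (bernsteinPoly (n + 2) α) := by
    funext q; rw [evalBary_bernsteinPoly]
  rw [cellBubble, h, grad_evalBary, grad_bary, ← evalBary_bernsteinPoly]
  have h2 : ((n + 1 : ℕ) : ℝ) + 1 = (n : ℝ) + 2 := by push_cast; ring
  rw [h2]
  set r : ℝ := (α ℓ : ℝ) / ((n : ℝ) + 2)
  simp only [formField, cellForm, Pi.add_apply, Pi.smul_apply, evalBary, map_add, smul_eval,
    apply_ite (eval _), map_zero, add_smul _ _ (baryGrad x _), Finset.sum_add_distrib, ite_smul,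
    zero_smul, Finset.sum_ite_eq', Finset.mem_univ, if_true, neg_mul, neg_smul _ (baryGrad x _),
    Finset.sum_neg_distrib, mul_smul r, Finset.smul_sum, sub_eq_add_neg]

theorem whitney_dotProduct (i j l k : Fin 4) (p : R3) :
    baryGrad x k ⬝ᵥ whitney x i j l p = bary x i p * gradVol x k j l -
      bary x j p * gradVol x k i l + bary x l p * gradVol x k i j := by
  simp only [whitney, grad_bary, dotProduct_add, dotProduct_sub, dotProduct_smul, smul_eq_mul,
    gradVol]

/-- The volume factor of the face element `χ_ℓ`. -/
def chiFactor (ℓ : Fin 4) : ℝ :=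
  gradVol x (ℓ.succAbove 0) (ℓ.succAbove 1) (ℓ.succAbove 2)

theorem chiFactor_ne_zero (ℓ : Fin 4) : chiFactor x ℓ ≠ 0 := by
  have h := Fin.succAbove_right_injective (p := ℓ)
  exact (isVolumeForm_gradVol x).ne_zero _ _ _ (h.ne (by decide)) (h.ne (by decide))
    (h.ne (by decide))

/-- Both sides are compared component by component. For `k ≠ ℓ` only one term of the Whitney form
survives pairing with `∇λ_k`; for `k = ℓ` all three survive and are collected by `∑ λ_j = 1`. -/
theorem chi_eq (ℓ : Fin 4) (p : R3) : chi x ℓ p = chiFactor x ℓ • (p - x ℓ) := by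
  have hT := isVolumeForm_gradVol x
  have hinj := Fin.succAbove_right_injective (p := ℓ)
  have hne := fun t => Fin.succAbove_ne ℓ t
  refine baryGrad_ext x fun k => ?_
  rw [chi, whitney_dotProduct, dotProduct_smul, baryGrad_dotProduct_sub_vertex, smul_eq_mul,
    chiFactor]
  have hs := sum_bary x p
  rw [sum_face hinj hne] at hs
  have s1 := hT.sum_eq_zero (ℓ.succAbove 1) (ℓ.succAbove 2)
  have s2 := hT.sum_eq_zero (ℓ.succAbove 0) (ℓ.succAbove 2)
  have s3 := hT.sum_eq_zero (ℓ.succAbove 0) (ℓ.succAbove 1)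
  simp only [sum_face hinj hne, hT.self_left, hT.self_outer] at s1 s2 s3
  have e1 := hT.swap_left (ℓ.succAbove 1) (ℓ.succAbove 0) (ℓ.succAbove 2)
  have e2 : gradVol x (ℓ.succAbove 2) (ℓ.succAbove 0) (ℓ.succAbove 1) =
      gradVol x (ℓ.succAbove 0) (ℓ.succAbove 1) (ℓ.succAbove 2) := by
    rw [hT.swap_left, hT.swap_right, neg_neg]
  by_cases hk : k = ℓ
  · have t1 : gradVol x ℓ (ℓ.succAbove 1) (ℓ.succAbove 2) =
        -gradVol x (ℓ.succAbove 0) (ℓ.succAbove 1) (ℓ.succAbove 2) := by linarith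
    have t2 : gradVol x ℓ (ℓ.succAbove 0) (ℓ.succAbove 2) =
        gradVol x (ℓ.succAbove 0) (ℓ.succAbove 1) (ℓ.succAbove 2) := by linarith
    have t3 : gradVol x ℓ (ℓ.succAbove 0) (ℓ.succAbove 1) =
        -gradVol x (ℓ.succAbove 0) (ℓ.succAbove 1) (ℓ.succAbove 2) := by linarith
    rw [hk, if_pos rfl, t1, t2, t3]
    linear_combination
      (-gradVol x (ℓ.succAbove 0) (ℓ.succAbove 1) (ℓ.succAbove 2)) * hs
  · rw [if_neg hk]
    obtain ⟨t, rfl⟩ := exists_face_eq hinj hne hk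
    fin_cases t <;>
      simp only [Fin.zero_eta, Fin.mk_one, Fin.reduceFinMk, hT.self_left, hT.self_outer, e1, e2] <;>
      ring

/-- The signs in `Υ` compensate the alternating orientation of the faces, so that `Υ_α` is one
constant times `B_α ∑ α_ℓ (x - x_ℓ)`. -/
theorem sign_mul_chiFactor (ℓ : Fin 4) :
    (-1 : ℝ) ^ ((ℓ : ℕ) + 1) * chiFactor x ℓ = chiFactor x 3 := by
  have hT := isVolumeForm_gradVol x
  have s1 := hT.sum_eq_zero 2 3
  have s2 := hT.sum_middle 0 3
  have s3 := hT.sum_middle 0 2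
  simp only [Fin.sum_univ_four, hT.self_left, hT.self_right, hT.self_outer] at s1 s2 s3
  have e := hT.swap_right 0 3 2
  have f0 : chiFactor x 0 = gradVol x 1 2 3 := rfl
  have f1 : chiFactor x 1 = gradVol x 0 2 3 := rfl
  have f2 : chiFactor x 2 = gradVol x 0 1 3 := rfl
  have f3 : chiFactor x 3 = gradVol x 0 1 2 := rfl
  fin_cases ℓ <;> simp [f0, f1, f2, f3] <;> linarith

theorem divBubble_eq (m : ℕ) (α : Fin 4 → ℕ) (p : R3) :
    divBubble x m α p = ∑ ℓ, (chiFactor x 3 * ((m : ℝ) + 1) * α ℓ) •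
      (bernstein x m α p • (p - x ℓ)) := by
  rw [divBubble, Finset.smul_sum]
  refine Finset.sum_congr rfl fun ℓ _ => ?_
  rw [chi_eq, smul_smul, smul_smul, smul_smul, ← sign_mul_chiFactor x ℓ]
  congr 1
  ring

theorem evalBary_vertexPoly (ℓ k : Fin 4) (p : R3) :
    evalBary x (vertexPoly ℓ k) p = baryGrad x k ⬝ᵥ (p - x ℓ) := by
  rw [baryGrad_dotProduct_sub_vertex, ← evalBary_sumX x p]
  simp [evalBary, vertexPoly, apply_ite (eval _)]

theorem baryGrad_dotProduct_divBubble (m : ℕ) (α : Fin 4 → ℕ) (k : Fin 4) (p : R3) :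
    baryGrad x k ⬝ᵥ divBubble x m α p =
      (chiFactor x 3 * ((m : ℝ) + 1)) * evalBary x (bubblePoly m α k) p := by
  have : evalBary x (bubblePoly m α k) p =
      bernstein x m α p * ∑ ℓ, (α ℓ : ℝ) * evalBary x (vertexPoly ℓ k) p := by
    rw [← evalBary_bernsteinPoly]
    simp [bubblePoly, evalBary]
  rw [this, divBubble_eq]
  simp only [dotProduct_sum, dotProduct_smul, smul_eq_mul, evalBary_vertexPoly, Finset.mul_sum]
  refine Finset.sum_congr rfl fun ℓ _ => by ring

/-- The scalar factors relating the fields of the collection to the formal polynomials. -/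
def familyFactor {n m : ℕ} {a : Fin 4 → Fin 4 → ℕ} {c : Fin 4 → ℕ} : Ind n m a c → ℝ
  | .inl ℓ => chiFactor x ℓ
  | .inr (.inl _) => 1
  | .inr (.inr (.inl _)) => 1
  | .inr (.inr (.inr (.inl _))) => 1
  | .inr (.inr (.inr (.inr _))) => chiFactor x 3 * ((m : ℝ) + 1)

theorem familyFactor_ne_zero {n m : ℕ} {a : Fin 4 → Fin 4 → ℕ} {c : Fin 4 → ℕ}
    (i : Ind n m a c) : familyFactor x i ≠ 0 := by
  rcases i with ℓ | _ | _ | _ | _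
  · exact chiFactor_ne_zero x ℓ
  · exact one_ne_zero
  · exact one_ne_zero
  · exact one_ne_zero
  · exact mul_ne_zero (chiFactor_ne_zero x 3) (by positivity)

theorem baryGrad_dotProduct_curl_cellBubble (n : ℕ) (ℓ : Fin 4) (α : Fin 4 → ℕ) (k : Fin 4)
    (p : R3) : baryGrad x k ⬝ᵥ curl (cellBubble x (n + 1) ℓ α) p =
      evalBary x (curlPoly (gradVol x) (cellForm n ℓ α) k) p := by
  rw [cellBubble_eq_formField, baryGrad_dotProduct_curl_formField, curlPoly_add, curlPoly_smul,
    curlPoly_pderiv (isVolumeForm_gradVol x), smul_zero, add_zero]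

theorem baryGrad_dotProduct_family (e : Fin 4 → Fin 3 → Fin 4) (n m t : ℕ)
    (a : Fin 4 → Fin 4 → ℕ) (c : Fin 4 → ℕ) (i : Ind n m a c) (k : Fin 4) (p : R3) :
    baryGrad x k ⬝ᵥ family x e n m a c i p =
      familyFactor x i * evalBary x (polyFamily (gradVol x) e n m t a c i k) p := by
  rcases i with ℓ | ⟨ℓ, α⟩ | ⟨ℓ, α⟩ | α | α
  · simp only [family, familyFactor, polyFamily, evalBary_sumX_pow_mul, evalBary_vertexPoly, chi_eq,
      dotProduct_smul, smul_eq_mul]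
  · simp only [family, familyFactor, polyFamily, evalBary_sumX_pow_mul, one_mul,
      faceBubble_eq_formField, baryGrad_dotProduct_curl_formField]
  · simp only [family, familyFactor, polyFamily, evalBary_sumX_pow_mul, one_mul,
      baryGrad_dotProduct_curl_cellBubble]
  · simp only [family, familyFactor, polyFamily, evalBary_sumX_pow_mul, one_mul,
      baryGrad_dotProduct_curl_cellBubble]
  · simp only [family, familyFactor, polyFamily, baryGrad_dotProduct_divBubble]

end
end BBTet

/-! ### Dimension count, membership and conclusion -/

namespace BBTet
open MvPolynomial
open scoped Matrix
noncomputable section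

/-! ### Cardinalities of the index sets -/

theorem card_piAntidiag {ι : Type*} [DecidableEq ι] [Fintype ι] (s : Finset ι) (n : ℕ) :
    (s.piAntidiag n).card = (s.card + n - 1).choose n := by
  rw [← Finset.card_finsuppAntidiag_nat_eq_choose]
  refine Finset.card_equiv Finsupp.equivFunOnFinite.symm fun α => ?_
  simp [Finset.subset_iff]

theorem ncard_idx (n : ℕ) : (idx n).ncard = (n + 3).choose 3 := by
  have : idx n = ↑(Finset.univ.piAntidiag n : Finset (Fin 4 → ℕ)) := by
    ext α; rw [Finset.mem_coe, mem_piAntidiag_univ]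
  rw [this, Set.ncard_coe_finset, card_piAntidiag, Finset.card_univ, Fintype.card_fin,
    show 4 + n - 1 = n + 3 by omega, Nat.choose_symm_add]

theorem ncard_faceIdx (n : ℕ) (ℓ : Fin 4) : (faceIdx n ℓ).ncard = (n + 2).choose 2 := by
  have : faceIdx n ℓ = ↑((Finset.univ.erase ℓ).piAntidiag n : Finset (Fin 4 → ℕ)) := by
    ext α; rw [Finset.mem_coe, mem_piAntidiag_erase]
  rw [this, Set.ncard_coe_finset, card_piAntidiag, Finset.card_erase_of_mem (Finset.mem_univ _),
    Finset.card_univ, Fintype.card_fin, show 4 - 1 + n - 1 = n + 2 by omega, Nat.choose_symm_add]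

theorem cellIdx_eq_image (n : ℕ) : cellIdx (n + 4) = (fun α => α + 1) '' idx n := by
  ext α
  constructor
  · rintro ⟨h, hpos⟩
    refine ⟨fun k => α k - 1, ?_, ?_⟩
    · have h' : ∑ k, α k = n + 4 := h
      change ∑ k, (α k - 1) = n
      have := hpos 0; have := hpos 1; have := hpos 2; have := hpos 3
      rw [Fin.sum_univ_four] at h' ⊢
      omega
    · funext k
      have := hpos k
      simp only [Pi.add_apply, Pi.one_apply]
      omega
  · rintro ⟨β, hβ, rfl⟩
    have h' : ∑ k, β k = n := hβ
    refine ⟨?_, fun k => by simp⟩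
    change ∑ k, (β k + 1) = n + 4
    simp [Finset.sum_add_distrib, h']

theorem cellIdx_eq_one_eq_image (n : ℕ) :
    {α | α ∈ cellIdx (n + 4) ∧ α 2 = 1} = (fun α => α + 1) '' faceIdx n 2 := by
  ext α
  rw [Set.mem_ofPred_eq, cellIdx_eq_image]
  constructor
  · rintro ⟨⟨β, hβ, rfl⟩, h⟩
    exact ⟨β, ⟨hβ, by simpa using h⟩, rfl⟩
  · rintro ⟨β, ⟨hβ, h⟩, rfl⟩
    exact ⟨⟨β, hβ, rfl⟩, by simpa using h⟩

theorem cellIdx_eq_empty {n : ℕ} (hn : n < 4) : cellIdx n = ∅ := by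
  rw [Set.eq_empty_iff_forall_notMem]
  rintro α ⟨h, hpos⟩
  have h' : ∑ k, α k = n := h
  have := hpos 0; have := hpos 1; have := hpos 2; have := hpos 3
  rw [Fin.sum_univ_four] at h'
  omega

theorem ncard_cellIdx (n : ℕ) : (cellIdx (n + 2)).ncard = (n + 1).choose 3 := by
  match n with
  | 0 => rw [cellIdx_eq_empty (by omega), Set.ncard_empty]; rfl
  | 1 => rw [cellIdx_eq_empty (by omega), Set.ncard_empty]; rfl
  | n + 2 => rw [cellIdx_eq_image, Set.ncard_image_of_injective _ (add_left_injective _), ncard_idx]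

theorem ncard_cellIdx_eq_one (n : ℕ) :
    {α | α ∈ cellIdx (n + 2) ∧ α 2 = 1}.ncard = n.choose 2 := by
  match n with
  | 0 => simp [cellIdx_eq_empty]
  | 1 => simp [cellIdx_eq_empty]
  | n + 2 =>
    rw [cellIdx_eq_one_eq_image, Set.ncard_image_of_injective _ (add_left_injective _),
      ncard_faceIdx]

theorem card_ind {n m : ℕ} {a : Fin 4 → Fin 4 → ℕ} (ha : ∀ ℓ, a ℓ ∈ faceIdx n ℓ)
    {c : Fin 4 → ℕ} (hc : c ∈ idx m) :
    Fintype.card (Ind n m a c) = 4 + (4 * ((n + 2).choose 2 - 1) + (2 * (n + 1).choose 3 +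
      (n.choose 2 + ((m + 3).choose 3 - 1)))) := by
  have h1 : ∀ ℓ, Fintype.card ↥(faceIdx n ℓ \ {a ℓ}) = (n + 2).choose 2 - 1 := fun ℓ => by
    rw [← Nat.card_eq_fintype_card, Nat.card_coe_set_eq, Set.ncard_sdiff_singleton_of_mem (ha ℓ),
      ncard_faceIdx]
  have h2 : Fintype.card ↥(cellIdx (n + 2)) = (n + 1).choose 3 := by
    rw [← Nat.card_eq_fintype_card, Nat.card_coe_set_eq, ncard_cellIdx]
  have h4 : Fintype.card ↥(idx m \ {c}) = (m + 3).choose 3 - 1 := by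
    rw [← Nat.card_eq_fintype_card, Nat.card_coe_set_eq, Set.ncard_sdiff_singleton_of_mem hc,
      ncard_idx]
  simp [h1, h2, h4, ncard_cellIdx_eq_one]

/-- By Pascal's rule all counts become linear in `n`, `n.choose 2` and `(n + 1).choose 3`, so the
dimension count is linear arithmetic. -/
theorem choose_relations (n : ℕ) :
    (n + 2).choose 2 = n.choose 2 + 2 * n + 1 ∧
    (n + 2).choose 3 = (n + 1).choose 3 + n.choose 2 + n ∧
    (n + 3).choose 3 = (n + 1).choose 3 + 2 * n.choose 2 + 3 * n + 1 := by
  have h1 := Nat.choose_succ_succ' n 1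
  have h2 := Nat.choose_succ_succ' (n + 1) 1
  have h3 := Nat.choose_succ_succ' (n + 1) 2
  have h4 := Nat.choose_succ_succ' (n + 2) 2
  simp only [Nat.choose_one_right, Nat.reduceAdd, add_assoc] at *
  omega

/-! ### Dimensions of the polynomial spaces -/

theorem finrank_polyOn_le (S : Set R3) (n : ℕ) :
    Module.finrank ℝ (polyOn S n) ≤ (n + 3).choose 3 := by
  refine (Submodule.finrank_map_le _ _).trans ?_
  rw [restrictTotalDegree, Module.finrank_eq_nat_card_basis (basisRestrictSupport ℝ _),
    ← ncard_idx, ← Nat.card_coe_set_eq]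
  have : Finite (idx n) := idx_finite n
  -- A slack exponent `n - |s|` turns monomials of degree at most `n` into four-entry multi-indices
  -- of total `n`.
  refine Nat.card_le_card_of_injective
    (fun s => ⟨![s.1 0, s.1 1, s.1 2, n - (s.1 0 + s.1 1 + s.1 2)], ?_⟩) ?_
  · have h : (s.1.sum fun _ e => e) ≤ n := s.2
    rw [Finsupp.sum_fintype _ _ (by simp), Fin.sum_univ_three] at h
    change ∑ k, _ = n
    simp only [Fin.sum_univ_four, Matrix.cons_val]
    omega
  · intro s t hst
    have h := congrArg Subtype.val hst
    have h0 := congrFun h 0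
    have h1 := congrFun h 1
    have h2 := congrFun h 2
    simp only [Matrix.cons_val] at h0 h1 h2
    ext k
    fin_cases k
    exacts [h0, h1, h2]

instance (n : ℕ) : Module.Finite ℝ (homogeneousSubmodule (Fin 3) ℝ n) :=
  Module.Finite.iff_fg.2 (homogeneousSubmodule_fg _ _ n)

theorem finrank_homPolyOn_le (S : Set R3) (n : ℕ) :
    Module.finrank ℝ (homPolyOn S n) ≤ (n + 2).choose 2 := by
  refine (Submodule.finrank_map_le _ _).trans ?_
  have e : homogeneousSubmodule (Fin 3) ℝ n = restrictSupport ℝ {d | d.degree = n} :=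
    homogeneousSubmodule_eq_finsupp_supported _ _ _
  rw [e, Module.finrank_eq_nat_card_basis (basisRestrictSupport ℝ _),
    ← ncard_faceIdx n 3, ← Nat.card_coe_set_eq]
  have : Finite (faceIdx n 3) := (idx_finite n).subset fun _ h => h.1
  refine Nat.card_le_card_of_injective
    (fun s => ⟨![s.1 0, s.1 1, s.1 2, 0], ?_, rfl⟩) ?_
  · have h : s.1.degree = n := s.2
    rw [Finsupp.degree_eq_sum, Fin.sum_univ_three] at h
    change ∑ k, _ = n
    simp only [Fin.sum_univ_four, Matrix.cons_val]
    omega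
  · intro s t hst
    have h := congrArg Subtype.val hst
    have h0 := congrFun h 0
    have h1 := congrFun h 1
    have h2 := congrFun h 2
    simp only [Matrix.cons_val] at h0 h1 h2
    ext k
    fin_cases k
    exacts [h0, h1, h2]

instance (S : Set R3) (n : ℕ) : Module.Finite ℝ (polyOn S n) :=
  Module.Finite.map _ _

instance (S : Set R3) (n : ℕ) : Module.Finite ℝ (homPolyOn S n) :=
  Module.Finite.map _ _

instance (S : Set R3) (n : ℕ) : Module.Finite ℝ (xHomPolyOn S n) :=
  Module.Finite.map _ _

/-- The components of a polynomial vector field. -/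
def vecPolyComponents (S : Set R3) (n : ℕ) : vecPolyOn S n →ₗ[ℝ] (Fin 3 → polyOn S n) where
  toFun v i := ⟨fun p => v.1 p i, v.2 i⟩
  map_add' _ _ := rfl
  map_smul' _ _ := rfl

theorem vecPolyComponents_injective (S : Set R3) (n : ℕ) :
    Function.Injective (vecPolyComponents S n) := by
  intro v w h
  ext p i
  exact congrFun (congrArg Subtype.val (congrFun h i)) p

instance (S : Set R3) (n : ℕ) : Module.Finite ℝ (vecPolyOn S n) :=
  Module.Finite.of_injective _ (vecPolyComponents_injective S n)

theorem finrank_vecPolyOn_le (S : Set R3) (n : ℕ) :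
    Module.finrank ℝ (vecPolyOn S n) ≤ 3 * (n + 3).choose 3 := by
  refine (LinearMap.finrank_le_finrank_of_injective (vecPolyComponents_injective S n)).trans ?_
  rw [Module.finrank_pi_fintype, Fin.sum_univ_three]
  have := finrank_polyOn_le S n
  omega

instance (S : Set R3) (n : ℕ) : Module.Finite ℝ (raviartThomas S n) :=
  inferInstanceAs (Module.Finite ℝ ↥(vecPolyOn S n ⊔ xHomPolyOn S n))

theorem finrank_raviartThomas_le (S : Set R3) (n : ℕ) :
    Module.finrank ℝ (raviartThomas S n) ≤ 3 * (n + 3).choose 3 + (n + 2).choose 2 :=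
  (Submodule.finrank_add_le_finrank_add_finrank _ _).trans <|
    add_le_add (finrank_vecPolyOn_le S n)
      ((Submodule.finrank_map_le _ _).trans (finrank_homPolyOn_le S n))

/-! ### Polynomials on the tetrahedron -/

variable (x : Vertices)

/-- The tetrahedron contains a sup-norm ball about its centroid, that is, a product of infinite
sets. -/
theorem eq_zero_of_evalOn_tet {P : MvPolynomial (Fin 3) ℝ} (h : evalOn (tet x) P = 0) : P = 0 := by
  have hc := x.centroid_mem_interior_convexHull
  rw [mem_interior_iff_mem_nhds] at hc
  obtain ⟨ε, hε, hball⟩ := Metric.mem_nhds_iff.1 hc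
  set p₀ := Finset.univ.centroid ℝ x
  refine funext_set (fun i => Metric.ball (p₀ i) ε)
    (fun i => infinite_of_mem_nhds _ (Metric.ball_mem_nhds _ hε)) fun p hp => ?_
  rw [← ball_pi _ hε] at hp
  rw [map_zero]
  exact congrFun h ⟨p, hball hp⟩

/-- A single component suffices: a nonzero homogeneous `Q` of degree `n` gives `Q * X 0` degree `n +
1`. -/
theorem disjoint_vecPolyOn_xHomPolyOn (n : ℕ) :
    Disjoint (vecPolyOn (tet x) n) (xHomPolyOn (tet x) n) := by
  rw [Submodule.disjoint_def]
  rintro v hv ⟨_, ⟨Q, hQ, rfl⟩, rfl⟩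
  obtain ⟨P, hP, hPv⟩ := hv 0
  have hPdeg : P.totalDegree ≤ n := (mem_restrictTotalDegree _ _ _).1 hP
  have hQ' : Q.IsHomogeneous n := hQ
  have h1 : P - Q * X 0 = 0 := by
    refine eq_zero_of_evalOn_tet x ?_
    funext p
    have := congrFun hPv p
    simp only [mulPos, evalOn, LinearMap.coe_mk, AddHom.coe_mk, Pi.smul_apply, smul_eq_mul] at this
    simp [evalOn, this]
  rw [sub_eq_zero] at h1
  have h2 : Q = 0 := by
    by_contra hQ0
    have h3 := (hQ'.mul (isHomogeneous_X ℝ (0 : Fin 3))).totalDegree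
      (mul_ne_zero hQ0 (X_ne_zero _))
    rw [← h1] at h3
    omega
  rw [h2, map_zero, map_zero]

/-- A homogeneous polynomial in the barycentric coordinates that vanishes on the tetrahedron is
zero. -/
theorem eq_zero_of_evalBary_tet {N : ℕ} {P : MvPolynomial (Fin 4) ℝ} (hP : P.IsHomogeneous N)
    (h : ∀ p ∈ tet x, evalBary x P p = 0) : P = 0 := by
  -- Any positive `y`, divided by its sum, is the barycentric coordinate vector of a point of the
  -- tetrahedron; homogeneity carries the vanishing there over to `y`.
  refine funext_set (fun _ => Set.Ioi (0 : ℝ)) (fun _ => Set.Ioi_infinite 0) fun y hy => ?_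
  have hy' : ∀ k, 0 < y k := fun k => hy k trivial
  set s := ∑ k, y k with hs
  have hs0 : 0 < s := Finset.sum_pos (fun k _ => hy' k) Finset.univ_nonempty
  have hw : ∑ k, y k / s = 1 := by rw [← Finset.sum_div, div_self hs0.ne']
  set p : R3 := Finset.univ.affineCombination ℝ x fun k => y k / s
  have hb : ∀ k, bary x k p = y k / s := fun k =>
    x.coord_apply_combination_of_mem (Finset.mem_univ k) hw
  have hp : p ∈ tet x := by
    rw [tet, x.convexHull_eq_nonneg_coord]
    intro k
    have := hb k
    rw [bary] at this
    rw [this]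
    exact (div_pos (hy' k) hs0).le
  have h0 := h p hp
  have e : y = fun k => s * bary x k p := by
    funext k
    rw [hb, mul_div_cancel₀ _ hs0.ne']
  have hscale : eval (fun k => s * bary x k p) P = s ^ N * evalBary x P p := by
    rw [evalBary, eval_eq', eval_eq', Finset.mul_sum]
    refine Finset.sum_congr rfl fun d hd => ?_
    have hdeg : ∑ k, d k = N := by
      rw [← Finsupp.degree_eq_sum]
      by_contra hne
      exact (mem_support_iff.1 hd) (hP.coeff_eq_zero hne)
    simp only [mul_pow, Finset.prod_mul_distrib, Finset.prod_pow_eq_pow_sum, hdeg]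
    ring
  rw [map_zero]
  nth_rewrite 1 [e]
  rw [hscale, h0, mul_zero]

/-- The barycentric coordinates as polynomials in the Cartesian coordinates. -/
def baryPoly (k : Fin 4) : MvPolynomial (Fin 3) ℝ :=
  ∑ i, C (baryGrad x k i) * X i + C (bary x k 0)

theorem eval_baryPoly (k : Fin 4) (p : R3) : eval p (baryPoly x k) = bary x k p := by
  have := bary_add x k 0 p
  rw [add_zero] at this
  rw [this]
  simp [baryPoly, dotProduct]

theorem totalDegree_baryPoly_le (k : Fin 4) : (baryPoly x k).totalDegree ≤ 1 := by
  refine (totalDegree_add _ _).trans (max_le ?_ (by simp))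
  refine totalDegree_finsetSum_le fun i _ => ?_
  refine (totalDegree_mul _ _).trans ?_
  simp

theorem exists_cartesian {N : ℕ} {P : MvPolynomial (Fin 4) ℝ} (hP : P.IsHomogeneous N) :
    ∃ Q : MvPolynomial (Fin 3) ℝ, Q.totalDegree ≤ N ∧ ∀ p, eval p Q = evalBary x P p := by
  refine ⟨∑ d ∈ P.support, C (coeff d P) * ∏ k, baryPoly x k ^ d k, ?_, fun p => ?_⟩
  · refine totalDegree_finsetSum_le fun d hd => ?_
    have hdeg : ∑ k, d k = N := by
      rw [← Finsupp.degree_eq_sum]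
      by_contra hne
      exact (mem_support_iff.1 hd) (hP.coeff_eq_zero hne)
    refine (totalDegree_mul _ _).trans ?_
    rw [totalDegree_C, zero_add]
    refine (totalDegree_finsetProd _ _).trans ?_
    rw [← hdeg]
    refine Finset.sum_le_sum fun k _ => (totalDegree_pow _ _).trans ?_
    exact (Nat.mul_le_mul_left _ (totalDegree_baryPoly_le x k)).trans (by simp)
  · rw [map_sum, evalBary, eval_eq' (fun k => bary x k p)]
    simp [eval_baryPoly]

theorem mem_polyOn {S : Set R3} {n : ℕ} {Q : MvPolynomial (Fin 3) ℝ} (hQ : Q.totalDegree ≤ n) :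
    (fun p : S => eval p.1 Q) ∈ polyOn S n :=
  ⟨Q, (mem_restrictTotalDegree _ _ _).2 hQ, rfl⟩

/-- The field is recovered as `∑ k, (∇λ_k · v) x_k`, with constant vectors `x_k`. -/
theorem mem_vecPolyOn_of_components {S : Set R3} {N : ℕ} {v : R3 → R3} {r : ℝ}
    {W : Fin 4 → MvPolynomial (Fin 4) ℝ} (hW : ∀ k, (W k).IsHomogeneous N)
    (hv : ∀ k p, baryGrad x k ⬝ᵥ v p = r * evalBary x (W k) p) :
    S.domRestrict v ∈ vecPolyOn S N := by
  intro i
  choose Q hQ hQ' using fun k => exists_cartesian x (hW k)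
  have : (fun p : S => S.domRestrict v p i) = ∑ k, (r * x k i) • fun p : S => eval p.1 (Q k) := by
    funext p
    have h := congrFun (sum_baryGrad_smul x (v p)) i
    simp only [Finset.sum_apply, Pi.smul_apply, smul_eq_mul, hv] at h
    rw [Set.domRestrict_apply, ← h]
    simp only [Finset.sum_apply, Pi.smul_apply, smul_eq_mul, hQ']
    refine Finset.sum_congr rfl fun k _ => by ring
  rw [this]
  exact Submodule.sum_mem _ fun k _ => Submodule.smul_mem _ _ (mem_polyOn (hQ k))

/-- With `H` the degree `n` part of `Q`, the field splits as `((Q - H) x - Q y) + H x`, where the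
first part has degree at most `n` and the second lies in `x ℙ̃ₙ`. -/
theorem smul_sub_mem_raviartThomas {S : Set R3} {n : ℕ} {Q : MvPolynomial (Fin 3) ℝ}
    (hQ : Q.totalDegree ≤ n) (y : R3) :
    (fun p : S => eval p.1 Q • (p.1 - y)) ∈ raviartThomas S n := by
  set H := homogeneousComponent n Q with hH
  have hlow : ∀ i : Fin 3, ((Q - H) * X i).totalDegree ≤ n := by
    intro i
    by_cases h0 : Q - H = 0
    · simp [h0]
    have hlt : ∀ d ∈ (Q - H).support, d.degree < n := by
      intro d hd
      have hd' := mem_support_iff.1 hd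
      rw [coeff_sub, hH, coeff_homogeneousComponent] at hd'
      have hne : d.degree ≠ n := fun h => hd' (by rw [if_pos h, sub_self])
      rw [if_neg hne, sub_zero] at hd'
      have := (le_totalDegree (mem_support_iff.2 hd')).trans hQ
      exact lt_of_le_of_ne this hne
    obtain ⟨d₀, hd₀⟩ := Finset.nonempty_iff_ne_empty.2 (mt support_eq_empty.1 h0)
    have hn := hlt d₀ hd₀
    have : (Q - H).totalDegree < n := (Finset.sup_lt_iff (by rw [bot_eq_zero]; omega)).2 hlt
    refine (totalDegree_mul _ _).trans ?_
    rw [totalDegree_X]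
    omega
  have h1 : (fun p : S => eval p.1 Q • (p.1 - y)) =
      (fun p : S => eval p.1 (Q - H) • p.1 - eval p.1 Q • y) + mulPos S (evalOn S H) := by
    funext p
    simp only [mulPos, evalOn, LinearMap.coe_mk, AddHom.coe_mk, Pi.add_apply, map_sub, sub_smul,
      smul_sub]
    abel
  rw [h1]
  refine Submodule.add_mem_sup (fun i => ?_)
    ⟨_, ⟨H, homogeneousComponent_isHomogeneous n Q, rfl⟩, rfl⟩
  have h2 : (fun p : S => (eval p.1 (Q - H) • p.1 - eval p.1 Q • y) i) =
      (fun p : S => eval p.1 ((Q - H) * X i)) - y i • fun p : S => eval p.1 Q := by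
    funext p
    simp [mul_comm]
  rw [h2]
  exact Submodule.sub_mem _ (mem_polyOn (hlow i)) (Submodule.smul_mem _ _ (mem_polyOn hQ))

/-! ### The bases -/

theorem family_mem_vecPolyOn (S : Set R3) (e : Fin 4 → Fin 3 → Fin 4) {n m : ℕ} (hmn : n = m + 1)
    (a : Fin 4 → Fin 4 → ℕ) (c : Fin 4 → ℕ) (i : Ind n m a c) :
    S.domRestrict (family x e n m a c i) ∈ vecPolyOn S n := by
  have h := mem_vecPolyOn_of_components x (S := S)
    (isHomogeneous_polyFamily (gradVol x) e (t := 0) (by omega) a c i)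
    (baryGrad_dotProduct_family x e n m 0 a c i)
  rwa [← hmn] at h

theorem family_mem_raviartThomas (S : Set R3) (e : Fin 4 → Fin 3 → Fin 4) (n : ℕ)
    (a : Fin 4 → Fin 4 → ℕ) (c : Fin 4 → ℕ) (i : Ind n n a c) :
    S.domRestrict (family x e n n a c i) ∈ raviartThomas S n := by
  -- The curls have degree `n`. The remaining fields may reach degree `n + 1`, but they are
  -- combinations of scalar polynomials times `x - x_ℓ`.
  rcases i with ℓ | ⟨ℓ, α⟩ | ⟨ℓ, α⟩ | α | α
  · have h := smul_sub_mem_raviartThomas (S := S) (n := n) (Q := C (chiFactor x ℓ)) (by simp) (x ℓ)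
    simp only [eval_C] at h
    convert h using 1
    funext p
    exact chi_eq x ℓ p
  · exact Submodule.mem_sup_left (mem_vecPolyOn_of_components x (r := 1)
      (isHomogeneous_curlPoly (gradVol x) (isHomogeneous_faceForm (e ℓ) α.2.1.1)) fun k p => by
        rw [family, faceBubble_eq_formField, baryGrad_dotProduct_curl_formField, one_mul])
  · exact Submodule.mem_sup_left (mem_vecPolyOn_of_components x (r := 1)
      (isHomogeneous_curlPoly (gradVol x) (isHomogeneous_cellForm _ α.2)) fun k p => by
        rw [family, baryGrad_dotProduct_curl_cellBubble, one_mul])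
  · exact Submodule.mem_sup_left (mem_vecPolyOn_of_components x (r := 1)
      (isHomogeneous_curlPoly (gradVol x) (isHomogeneous_cellForm _ α.2.1)) fun k p => by
        rw [family, baryGrad_dotProduct_curl_cellBubble, one_mul])
  · obtain ⟨Q, hQ, hQ'⟩ := exists_cartesian x (isHomogeneous_bernsteinPoly n α.2.1)
    have h : S.domRestrict (divBubble x n α.1) = ∑ ℓ, (chiFactor x 3 * ((n : ℝ) + 1) * α.1 ℓ) •
        fun p : S => eval p.1 Q • (p.1 - x ℓ) := by
      funext p
      rw [Set.domRestrict_apply, divBubble_eq]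
      simp only [Finset.sum_apply, Pi.smul_apply, hQ', evalBary_bernsteinPoly]
    change S.domRestrict (divBubble x n α.1) ∈ _
    rw [h]
    exact Submodule.sum_mem _ fun ℓ _ => Submodule.smul_mem _ _
      (smul_sub_mem_raviartThomas hQ _)

theorem linearIndependent_family {e : Fin 4 → Fin 3 → Fin 4}
    (he : ∀ ℓ, Function.Injective (e ℓ)) (he' : ∀ ℓ k, e ℓ k ≠ ℓ) {n m t : ℕ}
    (hmt : m + 1 = t + n) {a : Fin 4 → Fin 4 → ℕ} (ha : ∀ ℓ, a ℓ ∈ faceIdx n ℓ)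
    {c : Fin 4 → ℕ} (hc : c ∈ idx m) :
    LinearIndependent ℝ fun i => (tet x).domRestrict (family x e n m a c i) := by
  rw [Fintype.linearIndependent_iff]
  intro r hr i
  have h := polyFamily_independent (isVolumeForm_gradVol x) he he' hmt ha hc
    (r := fun i => r i * familyFactor x i) (fun k => by
      refine eq_zero_of_evalBary_tet x (N := m + 1) (IsHomogeneous.sum _ _ _ fun i _ =>
        isHomogeneous_smul (isHomogeneous_polyFamily _ e hmt a c i k) _) fun p hp => ?_
      have h1 := congrFun hr ⟨p, hp⟩
      simp only [Finset.sum_apply, Pi.smul_apply, Set.domRestrict_apply, Pi.zero_apply] at h1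
      have h2 := congrArg (fun v => baryGrad x k ⬝ᵥ v) h1
      simp only [dotProduct_sum, dotProduct_smul, baryGrad_dotProduct_family x e n m t,
        dotProduct_zero, smul_eq_mul] at h2
      rw [← h2]
      simp only [evalBary, map_sum, smul_eval]
      exact Finset.sum_congr rfl fun i _ => mul_assoc _ _ _)
  exact (mul_eq_zero.1 (h i)).resolve_right (familyFactor_ne_zero x i)

theorem exists_basis_of_finrank_le {ι V : Type*} [Fintype ι] [AddCommGroup V] [Module ℝ V]
    {M : Submodule ℝ V} [Module.Finite ℝ M] {v : ι → V} (hv : LinearIndependent ℝ v)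
    (hM : ∀ i, v i ∈ M) (hdim : Module.finrank ℝ M ≤ Fintype.card ι) :
    ∃ b : Module.Basis ι ℝ M, ∀ i, (b i : V) = v i := by
  have hli : LinearIndependent ℝ fun i => (⟨v i, hM i⟩ : M) :=
    LinearIndependent.of_comp M.subtype hv
  refine ⟨basisOfLinearIndependentOfCardEqFinrank' _ hli
    (le_antisymm hli.fintype_card_le_finrank hdim), fun i => ?_⟩
  rw [coe_basisOfLinearIndependentOfCardEqFinrank']

end
end BBTet
theorem theorem4p2 (x : Vertices)
    -- for each `ℓ`, an arbitrary ordering of the vertices of the face opposite to vertex `ℓ`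
    (e : Fin 4 → Fin 3 → Fin 4) (he : ∀ ℓ, Function.Injective (e ℓ)) (he' : ∀ ℓ k, e ℓ k ≠ ℓ)
    (n : ℕ)
    -- the arbitrary indices left out on the four faces
    (a : Fin 4 → Fin 4 → ℕ) (ha : ∀ ℓ, a ℓ ∈ faceIdx n ℓ) :
    -- the sum defining the Raviart–Thomas space is direct, and the first set is a basis of it
    (Disjoint (vecPolyOn (tet x) n) (xHomPolyOn (tet x) n) ∧
      ∀ c ∈ idx n, ∃ b : Module.Basis (Ind n n a c) ℝ (raviartThomas (tet x) n),
        ∀ i, (b i : tet x → R3) = (tet x).domRestrict (family x e n n a c i)) ∧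
    -- for `n ≥ 1`, the second set is a basis of `ℙₙ³`
    (1 ≤ n → ∀ c ∈ idx (n - 1), ∃ b : Module.Basis (Ind n (n - 1) a c) ℝ (vecPolyOn (tet x) n),
        ∀ i, (b i : tet x → R3) = (tet x).domRestrict (family x e n (n - 1) a c i)) := by
  refine ⟨⟨disjoint_vecPolyOn_xHomPolyOn x n, fun c hc => ?_⟩, fun hn c hc => ?_⟩
  · refine exists_basis_of_finrank_le
      (linearIndependent_family x he he' (t := 1) (by omega) ha hc)
      (family_mem_raviartThomas x _ e n a c) ((finrank_raviartThomas_le _ n).trans ?_)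
    rw [card_ind ha hc]
    obtain ⟨h1, h2, h3⟩ := choose_relations n
    omega
  · refine exists_basis_of_finrank_le
      (linearIndependent_family x he he' (t := 0) (by omega) ha hc)
      (family_mem_vecPolyOn x _ e (by omega) a c) ((finrank_vecPolyOn_le _ n).trans ?_)
    rw [card_ind ha hc, show n - 1 + 3 = n + 2 by omega]
    obtain ⟨h1, h2, h3⟩ := choose_relations n
    omega
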